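/- All graphs are finite, without loops or multiple edges. A graph is cubic if every vertex has exactly three neighbours. A \emph{snark} is a connected cubic graph of girth at least $5$ that is cyclically $4$-edge-connected (that is, whenever $C_1,C_2$ are vertex-disjoint cycles and $S$ is a set of at most $3$ edges, none of them an edge of $C_1$ or $C_2$, the graph with the edges in $S$ deleted contains a path from a vertex of $C_1$ to a vertex of $C_2$) and that has no proper edge colouring with three colours. For an edge $e=uv$ of a graph $G$, let $G_e$ be the graph obtained by deleting $u$ and $v$ (with all edges meeting them), joining the two other neighbours of $u$ by a new edge, and joining the two other neighbours of $v$ by a new edge. Put $$\psi(G,e)=\tfrac13\,\bigl|ED(G_e)\bigr|,$$ where $ED(H)$ is the set of partitions of the edge set of $H$ into three classes such that no two adjacent edges lie in the same class. \textbf{Theorem 4.8.} Let $G'$ and $G^*$ be disjoint snarks. Let $P'$ be a pentagon ($5$-cycle) in $G'$ with vertices $u_k$ and edges $u_ku_{k+1}$, and let $P^*$ be a pentagon in $G^*$ with vertices $v_k$ and edges $v_kv_{k+1}$, where $k\in\mathbb Z/5\mathbb Z$. Let $G_0'=G'-\{u_k : k\in\mathbb Z/5\mathbb Z\}$ and $G_0^*=G^*-\{v_k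 : k\in\mathbb Z/5\mathbb Z\}$. Let $t_k$ be the vertex of $G_0'$ adjacent to $u_k$ in $G'$, and let $w_k$ be the vertex of $G_0^*$ adjacent to $v_k$ in $G^*$. Let $G$ be the graph that consists of $G_0'$, $G_0^*$ and the five new edges $t_kw_{2k}$, $k\in\mathbb Z/5\mathbb Z$ (indices mod $5$). Write $\psi(G',P')$ for the number $\psi(G',f)$, where $f$ is any edge of $P'$, and $\psi(G^*,P^*)$ for the number $\psi(G^*,f)$, where $f$ is any edge of $P^*$; the equations below hold for every choice of these edges $f$. Then: (A) every edge $e$ of $G_0^*$ is an edge of $G$, and $\psi(G,e)=\psi(G^*,e)\cdot\psi(G',P')$; (B) every edge $e$ of $G_0'$ is an edge of $G$, and $\psi(G,e)=\psi(G',e)\cdot\psi(G^*,P^*)$. -/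

import Mathlib

namespace Snark

/-- Cyclic `n`-edge-connectivity of `G` (for `n ≥ 1`): if `C₁`, `C₂` are vertex-disjoint cycles of
`G` and `S` is a set of at most `n - 1` edges of `G`, none of them on `C₁` or `C₂`, then some vertex
of `C₁` is still joined to some vertex of `C₂` by a path in `G - S`. -/
def CyclicallyEdgeConnected {V : Type*} (G : SimpleGraph V) (n : ℕ) : Prop :=
  ∀ (a b : V) (C₁ : G.Walk a a) (C₂ : G.Walk b b), C₁.IsCycle → C₂.IsCycle →
    (∀ x, x ∈ C₁.support → x ∉ C₂.support) →
    ∀ S : Finset (Sym2 V), (S : Set (Sym2 V)) ⊆ G.edgeSet → S.card < n →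
      (∀ f ∈ S, f ∉ C₁.edges ∧ f ∉ C₂.edges) →
      ∃ x ∈ C₁.support, ∃ y ∈ C₂.support, (G.deleteEdges (S : Set (Sym2 V))).Reachable x y

/-- A snark (used for finite `V`): a connected cubic graph of girth at least 5 that is cyclically
4-edge-connected and has no proper edge colouring with three colours. -/
structure IsSnark {V : Type*} (G : SimpleGraph V) : Prop where
  connected : G.Connected
  cubic : ∀ x, (G.neighborSet x).ncard = 3
  five_le_girth : 5 ≤ G.egirth
  cyclicallyEdgeConnected : CyclicallyEdgeConnected G 4
  not_colorable : ¬ G.lineGraph.Colorable 3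

/-- The 3-edge-decompositions `ED(G)`: the partitions of the edge set of `G` into exactly three
(nonempty) classes, none of which contains two adjacent edges. -/
def EdgeDecomposition {V : Type*} (G : SimpleGraph V) : Type _ :=
  {δ : G.lineGraph.Partition // δ.parts.ncard = 3}

/-- The graph `G_e` for an edge `e = uv`: the two endpoints of `e` are deleted; then the two
other neighbours of `u` are joined by a new edge, and so are the two other neighbours of `v`. -/
def reduction {V : Type*} (G : SimpleGraph V) (e : Sym2 V) : SimpleGraph {x : V // x ∉ e} where
  Adj x y := x ≠ y ∧ (G.Adj x y ∨ ∃ u ∈ e, G.Adj u x ∧ G.Adj u y)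
  symm := ⟨by
    rintro x y ⟨hne, h | ⟨u, hu, hx, hy⟩⟩
    · exact ⟨hne.symm, Or.inl h.symm⟩
    · exact ⟨hne.symm, Or.inr ⟨u, hu, hy, hx⟩⟩⟩
  loopless := ⟨fun _ h => h.1 rfl⟩

/-- The Kászonyi number `ψ(G, e) = (1/3) · card ED(G_e)` of a graph `G` and an edge `e` of `G`. -/
noncomputable def psi {V : Type*} (G : SimpleGraph V) (e : Sym2 V) : ℚ :=
  (1 / 3) * (Nat.card (EdgeDecomposition (reduction G e)) : ℚ)

/-- `u 0, u 1, u 2, u 3, u 4` are, in cyclic order, the vertices of a pentagon (5-cycle) of `G`. -/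
def IsPentagon {V : Type*} (G : SimpleGraph V) (u : ZMod 5 → V) : Prop :=
  Function.Injective u ∧ ∀ k, G.Adj (u k) (u (k + 1))

/-- The graph `G - {u k}` obtained from `G` by deleting the vertices `u k` and all edges that
meet one of them. -/
def deletePentagon {V : Type*} (G : SimpleGraph V) (u : ZMod 5 → V) :
    SimpleGraph {x : V // x ∉ Set.range u} :=
  G.comap Subtype.val

/-- The graph that consists of disjoint copies of `G` and `H` and of the five further edges from
`t k` (in `G`) to `w (2 * k)` (in `H`), where `k` runs through the integers mod 5. -/
def pentagonGluing {A B : Type*} (G : SimpleGraph A) (H : SimpleGraph B)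
    (t : ZMod 5 → A) (w : ZMod 5 → B) : SimpleGraph (A ⊕ B) :=
  SimpleGraph.sum G H ⊔
    SimpleGraph.fromEdgeSet (Set.range fun k : ZMod 5 => s(Sum.inl (t k), Sum.inr (w (2 * k))))

end Snark

/-! Count proper 3-edge-colourings instead of partitions. In a graph with a vertex of degree at
least three every such colouring uses all three colours, so `psi` of an edge is the number of
colourings of the reduced graph divided by 18 = 3 · 3!. Cutting the five edges between a pentagon
(or a glued-in side) and the rest leaves two sides with five coloured semiedges each, and
`colorCount_glue` writes the number of colourings as a sum, over the boundary colours `c`, of the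
product of the counts of the two sides.

In the graph that remains of a cubic graph after deleting a pentagon, parity forces the five
boundary colours to occur 3, 1 and 1 times. The two colours that occur once are then at consecutive
indices (`IsNear`) or not (`IsFar`). A pentagon admits exactly one colouring for each near pattern
and none for any other. Since a snark has no 3-edge-colouring, its remainder therefore realises no
near pattern. Kempe switches permute the far patterns and lose no colouring, so all of them occur
equally often, say `x` times (`boundaryCount_eq_ite`). Exactly 18 far patterns extend to a pentagon
with one edge reduced, each in one way, so `psi` of every pentagon edge is 18x/18 = x
(`psi_pentagon`).

Multiplication by 2 on ℤ/5ℤ exchanges neighbouring and non-neighbouring indices, hence near and far.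
Seen through the edges t_k w_{2k}, the remainder of one snark contributes `x` for each near pattern
of the other side and 0 otherwise. The pentagon it replaces contributes 1 and 0. So, after reducing
an edge of the other side, the sum for the glued graph is `x` times the sum for the original snark.
-/

namespace Snark

open SimpleGraph

/-! ### Partitions into independent sets versus surjective colourings -/

section Decompositions

variable {E : Type*} {Γ : SimpleGraph E} {n : ℕ}

/-- Numbering the parts of a partition into independent sets gives a surjective colouring. -/
noncomputable def coloringOfPartition
    (x : Σ δ : {δ : Γ.Partition // δ.parts.ncard = n}, δ.1.parts ≃ Fin n) :
    {C : Γ.Coloring (Fin n) // Function.Surjective C} :=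
  ⟨Coloring.mk (fun e => x.2 ⟨x.1.1.partOfVertex e, x.1.1.partOfVertex_mem e⟩) (by
      intro a b hab h
      exact x.1.1.partOfVertex_ne_of_adj hab (congrArg Subtype.val (x.2.injective h))),
    by
      intro i
      obtain ⟨⟨p, hp⟩, hi⟩ := x.2.surjective i
      obtain ⟨e, he⟩ := Setoid.nonempty_of_mem_partition x.1.1.isPartition hp
      refine ⟨e, ?_⟩
      have : x.1.1.partOfVertex e = p :=
        (x.1.1.isPartition.2 e).unique ⟨x.1.1.partOfVertex_mem e, x.1.1.mem_partOfVertex e⟩ ⟨hp, he⟩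
      rw [← hi]
      exact congrArg x.2 (Subtype.ext this)⟩

theorem coloringOfPartition_apply_eq_iff
    (x : Σ δ : {δ : Γ.Partition // δ.parts.ncard = n}, δ.1.parts ≃ Fin n) (p : x.1.1.parts)
    (e : E) : (coloringOfPartition x).1 e = x.2 p ↔ e ∈ p.1 := by
  have h : (coloringOfPartition x).1 e =
    x.2 ⟨x.1.1.partOfVertex e, x.1.1.partOfVertex_mem e⟩ := rfl
  rw [h, x.2.injective.eq_iff]
  constructor
  · rintro rfl
    exact x.1.1.mem_partOfVertex e
  · intro he
    exact Subtype.ext ((x.1.1.isPartition.2 e).unique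
      ⟨x.1.1.partOfVertex_mem e, x.1.1.mem_partOfVertex e⟩ ⟨p.2, he⟩)

theorem coloringOfPartition_bijective :
    Function.Bijective (coloringOfPartition (Γ := Γ) (n := n)) := by
  constructor
  · intro x y hxy
    have key : ∀ x : (Σ δ : {δ : Γ.Partition // δ.parts.ncard = n}, δ.1.parts ≃ Fin n),
        x.1.1.parts = Set.range fun i => {e | (coloringOfPartition x).1 e = i} := by
      intro x
      ext p
      constructor
      · intro hp
        exact ⟨x.2 ⟨p, hp⟩, Set.ext fun e => coloringOfPartition_apply_eq_iff x ⟨p, hp⟩ e⟩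
      · rintro ⟨i, rfl⟩
        obtain ⟨p, rfl⟩ := x.2.surjective i
        have : {e | (coloringOfPartition x).1 e = x.2 p} = p.1 :=
          Set.ext fun e => coloringOfPartition_apply_eq_iff x p e
        simp only [this]
        exact p.2
    have hp : x.1.1.parts = y.1.1.parts := by rw [key x, key y, hxy]
    obtain ⟨⟨⟨p, hp1, hp2⟩, hn⟩, σ⟩ := x
    obtain ⟨⟨⟨q, hq1, hq2⟩, hm⟩, τ⟩ := y
    obtain rfl : p = q := hp
    congr 1
    ext1 r
    obtain ⟨e, he⟩ := Setoid.nonempty_of_mem_partition hp1 r.2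
    rw [← (coloringOfPartition_apply_eq_iff ⟨⟨⟨p, hp1, hp2⟩, hn⟩, σ⟩ r e).2 he,
      ← (coloringOfPartition_apply_eq_iff ⟨⟨⟨p, hq1, hq2⟩, hm⟩, τ⟩ r e).2 he, hxy]
  · rintro ⟨C, hC⟩
    let g : Fin n → Set E := fun i => {e | C e = i}
    have hg : Function.Injective g := by
      intro i j hij
      obtain ⟨e, rfl⟩ := hC i
      have : e ∈ g j := hij ▸ (rfl : e ∈ g (C e))
      exact this
    let δ : Γ.Partition :=
      { parts := Set.range g
        isPartition := by
          constructor
          · rintro ⟨i, hi⟩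
            obtain ⟨e, he⟩ := hC i
            have : e ∈ g i := he
            rw [hi] at this
            exact this
          · intro e
            refine ⟨g (C e), ⟨⟨_, rfl⟩, rfl⟩, ?_⟩
            rintro _ ⟨⟨i, rfl⟩, hi⟩
            have hi' : C e = i := hi
            rw [hi']
        independent := by
          rintro _ ⟨i, rfl⟩ a ha b hb _ hab
          have ha' : C a = i := ha
          have hb' : C b = i := hb
          exact C.valid hab (ha'.trans hb'.symm) }
    have hδ : δ.parts.ncard = n := by
      change (Set.range g).ncard = n
      rw [← Set.image_univ, Set.ncard_image_of_injective _ hg, Set.ncard_univ, Nat.card_fin]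
    refine ⟨⟨⟨δ, hδ⟩, (Equiv.ofInjective g hg).symm⟩, Subtype.ext (RelHom.ext fun e => ?_)⟩
    have := (coloringOfPartition_apply_eq_iff ⟨⟨δ, hδ⟩, (Equiv.ofInjective g hg).symm⟩
      (Equiv.ofInjective g hg (C e)) e).2 rfl
    rw [this]
    exact Equiv.symm_apply_apply _ _

/-- A surjective colouring is a partition into `n` independent classes together with a numbering of
the classes, and there are `n!` numberings. -/
theorem card_surjective_coloring [Finite E] :
    Nat.card {C : Γ.Coloring (Fin n) // Function.Surjective C} =
      n.factorial * Nat.card {δ : Γ.Partition // δ.parts.ncard = n} := by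
  classical
  rw [← Nat.card_congr (Equiv.ofBijective _ (coloringOfPartition_bijective (Γ := Γ) (n := n)))]
  have hfin : Finite Γ.Partition :=
    Finite.of_injective (fun P : Γ.Partition => P.parts) (by
      rintro ⟨p, _, _⟩ ⟨q, _, _⟩ h
      obtain rfl : p = q := h
      rfl)
  have : Fintype {δ : Γ.Partition // δ.parts.ncard = n} := Fintype.ofFinite _
  rw [Nat.card_sigma]
  have h : ∀ δ : {δ : Γ.Partition // δ.parts.ncard = n},
      Nat.card (δ.1.parts ≃ Fin n) = n.factorial := by
    intro δ
    have e : Fin n ≃ δ.1.parts := (Finite.equivFinOfCardEq δ.2).symm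
    rw [Nat.card_congr (Equiv.equivCongr e.symm (Equiv.refl _)), Nat.card_perm, Nat.card_fin]
  rw [Finset.sum_congr rfl fun δ _ => h δ, Finset.sum_const, Finset.card_univ,
    Nat.card_eq_fintype_card, smul_eq_mul, mul_comm]

end Decompositions

/-! ### From edge partitions to edge colourings -/

section Counting

variable {V W : Type*}

/-- Some vertex has three different neighbours. -/
def HasClaw (K : SimpleGraph V) : Prop :=
  ∃ x a b c, K.Adj x a ∧ K.Adj x b ∧ K.Adj x c ∧ a ≠ b ∧ a ≠ c ∧ b ≠ c

theorem HasClaw.map_iso {K : SimpleGraph V} {M : SimpleGraph W} (h : HasClaw K) (φ : K ≃g M) :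
    HasClaw M := by
  obtain ⟨x, a, b, c, ha, hb, hc, hab, hac, hbc⟩ := h
  exact ⟨φ x, φ a, φ b, φ c, φ.map_adj_iff.2 ha, φ.map_adj_iff.2 hb, φ.map_adj_iff.2 hc,
    φ.injective.ne hab, φ.injective.ne hac, φ.injective.ne hbc⟩

theorem lineGraph_coloring_ne {K : SimpleGraph V} {α : Type*} (C : K.lineGraph.Coloring α)
    {e e' : K.edgeSet} {x : V} (hx : x ∈ e.1) (hx' : x ∈ e'.1) (h : e ≠ e') : C e ≠ C e' :=
  C.valid ⟨h, x, hx, hx'⟩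

theorem HasClaw.surjective_coloring {K : SimpleGraph V} (h : HasClaw K)
    (C : K.lineGraph.Coloring (Fin 3)) : Function.Surjective C := by
  obtain ⟨x, a, b, c, ha, hb, hc, hab, hac, hbc⟩ := h
  have hne : ∀ {y z : V} (hy : K.Adj x y) (hz : K.Adj x z), y ≠ z →
      C ⟨s(x, y), hy⟩ ≠ C ⟨s(x, z), hz⟩ := by
    intro y z hy hz hyz
    refine lineGraph_coloring_ne C (x := x) (by simp) (by simp) ?_
    intro h
    exact hyz (Sym2.congr_right.1 (congrArg Subtype.val h))
  have key : ∀ p q r i : Fin 3, p ≠ q → p ≠ r → q ≠ r → i = p ∨ i = q ∨ i = r := by decide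
  intro i
  rcases key _ _ _ i (hne ha hb hab) (hne ha hc hac) (hne hb hc hbc) with h | h | h <;>
    exact ⟨_, h.symm⟩

/-- The number of proper edge colourings with three colours. -/
noncomputable def colorCount (K : SimpleGraph V) : ℕ := Nat.card (K.lineGraph.Coloring (Fin 3))

theorem colorCount_congr {K : SimpleGraph V} {M : SimpleGraph W} (φ : K ≃g M) :
    colorCount K = colorCount M := by
  refine Nat.card_congr
    { toFun := fun C => C.comp φ.lineGraph.symm.toHom
      invFun := fun C => C.comp φ.lineGraph.toHom
      left_inv := fun C => RelHom.ext fun e => ?_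
      right_inv := fun C => RelHom.ext fun e => ?_ }
  · exact congrArg C (φ.lineGraph.symm_apply_apply e)
  · exact congrArg C (φ.lineGraph.apply_symm_apply e)

/-- The 18 is the 3 in the definition of `psi` times the 3! numberings of three classes; the claw
makes every colouring surjective. -/
theorem psi_eq_colorCount [Finite V] {K : SimpleGraph V} {e : Sym2 V} {M : SimpleGraph W}
    (φ : reduction K e ≃g M) (hM : HasClaw M) : psi K e = colorCount M / 18 := by
  have h := card_surjective_coloring (Γ := (reduction K e).lineGraph) (n := 3)
  rw [Nat.card_congr (Equiv.subtypeUnivEquiv (hM.map_iso φ.symm).surjective_coloring)] at h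
  rw [← colorCount_congr φ, psi, colorCount, h, EdgeDecomposition]
  simp only [Nat.factorial]
  push_cast
  ring

end Counting

/-! ### Gluing along semiedges and the product formula -/

section Glue

variable {A B ι κ : Type*}

/-- Disjoint copies of `L` and `H` together with an edge from `t k` to `w k` for every `k`. -/
def glue (L : SimpleGraph A) (H : SimpleGraph B) (t : ι → A) (w : ι → B) : SimpleGraph (A ⊕ B) :=
  SimpleGraph.sum L H ⊔
    SimpleGraph.fromEdgeSet (Set.range fun k => s(Sum.inl (t k), Sum.inr (w k)))

variable {L : SimpleGraph A} {H : SimpleGraph B} {t : ι → A} {w : ι → B}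

@[simp] theorem glue_adj_inl_inl {a a' : A} :
    (glue L H t w).Adj (.inl a) (.inl a') ↔ L.Adj a a' := by
  simp [glue]

@[simp] theorem glue_adj_inr_inr {b b' : B} :
    (glue L H t w).Adj (.inr b) (.inr b') ↔ H.Adj b b' := by
  simp [glue]

@[simp] theorem glue_adj_inl_inr {a : A} {b : B} :
    (glue L H t w).Adj (.inl a) (.inr b) ↔ ∃ k, t k = a ∧ w k = b := by
  simp [glue]

@[simp] theorem glue_adj_inr_inl {a : A} {b : B} :
    (glue L H t w).Adj (.inr b) (.inl a) ↔ ∃ k, t k = a ∧ w k = b := by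
  rw [adj_comm, glue_adj_inl_inr]

/-- Exchanging the two sides of a gluing. -/
def glueComm (L : SimpleGraph A) (H : SimpleGraph B) (t : ι → A) (w : ι → B) :
    glue L H t w ≃g glue H L w t where
  toEquiv := Equiv.sumComm A B
  map_rel_iff' := by
    rintro (a | b) (a' | b') <;> simp [and_comm]

/-- `f` is a proper 3-edge-colouring of `H` that, together with the colour `c k` on a semiedge at
`w k` for every `k`, has no two equal colours at a vertex. -/
structure IsBoundaryColoring (H : SimpleGraph B) (w : ι → B) (c : ι → Fin 3)
    (f : H.edgeSet → Fin 3) : Prop where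
  edge : ∀ ⦃x e e'⦄, x ∈ e.1 → x ∈ e'.1 → e ≠ e' → f e ≠ f e'
  semiedge : ∀ ⦃k e⦄, w k ∈ e.1 → f e ≠ c k
  terminal : ∀ ⦃k l⦄, w k = w l → k ≠ l → c k ≠ c l

/-- The number of 3-edge-colourings of `H` with semiedges of colours `c k` at `w k`. -/
noncomputable def boundaryCount (H : SimpleGraph B) (w : ι → B) (c : ι → Fin 3) : ℕ :=
  Nat.card {f : H.edgeSet → Fin 3 // IsBoundaryColoring H w c f}

theorem boundaryCount_reindex (σ : κ ≃ ι) (c : ι → Fin 3) :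
    boundaryCount H (w ∘ σ) (c ∘ σ) = boundaryCount H w c := by
  refine Nat.card_congr (Equiv.subtypeEquivRight fun f => ⟨fun h => ⟨h.edge, ?_, ?_⟩, fun h =>
    ⟨h.edge, fun k e hk => h.semiedge hk, fun k l hkl hne => h.terminal hkl (σ.injective.ne hne)⟩⟩)
  · intro k e hk
    obtain ⟨k, rfl⟩ := σ.surjective k
    exact h.semiedge hk
  · intro k l hkl hne
    obtain ⟨k, rfl⟩ := σ.surjective k
    obtain ⟨l, rfl⟩ := σ.surjective l
    exact h.terminal hkl (fun h => hne (congrArg σ h))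

/-- The edges of a gluing. -/
def glueEdge (L : SimpleGraph A) (H : SimpleGraph B) (t : ι → A) (w : ι → B) :
    L.edgeSet ⊕ H.edgeSet ⊕ ι → (glue L H t w).edgeSet
  | .inl e => ⟨e.1.map .inl, by
      obtain ⟨e, he⟩ := e
      induction e with | _ a b => simpa using he⟩
  | .inr (.inl e) => ⟨e.1.map .inr, by
      obtain ⟨e, he⟩ := e
      induction e with | _ a b => simpa using he⟩
  | .inr (.inr k) => ⟨s(.inl (t k), .inr (w k)), by simpa using ⟨k, rfl, rfl⟩⟩

theorem glueEdge_bijective (h : Function.Injective fun k => (t k, w k)) :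
    Function.Bijective (glueEdge L H t w) := by
  constructor
  · rintro (⟨e, he⟩ | ⟨e, he⟩ | k) (⟨e', he'⟩ | ⟨e', he'⟩ | k') heq <;>
      have heq := congrArg Subtype.val heq <;> simp only [glueEdge] at heq
    · simpa using Sym2.map.injective Sum.inl_injective heq
    · induction e with | _ a b => induction e' with | _ a' b' => simp at heq
    · induction e with | _ a b => simp at heq
    · induction e with | _ a b => induction e' with | _ a' b' => simp at heq
    · simpa using Sym2.map.injective Sum.inr_injective heq
    · induction e with | _ a b => simp at heq
    · induction e' with | _ a b => simp at heq
    · induction e' with | _ a b => simp at heq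
    · have : t k = t k' ∧ w k = w k' := by simpa using heq
      rw [h (Prod.ext this.1 this.2)]
  · rintro ⟨e, he⟩
    induction e with
    | _ x y =>
      rcases x with a | b <;> rcases y with a' | b'
      · exact ⟨.inl ⟨s(a, a'), by simpa using he⟩, rfl⟩
      · obtain ⟨k, rfl, rfl⟩ : ∃ k, t k = a ∧ w k = b' := by simpa using he
        exact ⟨.inr (.inr k), rfl⟩
      · obtain ⟨k, rfl, rfl⟩ : ∃ k, t k = a' ∧ w k = b := by simpa using he
        exact ⟨.inr (.inr k), Subtype.ext Sym2.eq_swap⟩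
      · exact ⟨.inr (.inl ⟨s(b, b'), by simpa using he⟩), rfl⟩

theorem sigma_coloring_ext {x y : Σ c : ι → Fin 3,
      {f // IsBoundaryColoring L t c f} × {g // IsBoundaryColoring H w c g}} (hc : x.1 = y.1)
    (hf : x.2.1.1 = y.2.1.1) (hg : x.2.2.1 = y.2.2.1) : x = y := by
  obtain ⟨c, ⟨f, _⟩, ⟨g, _⟩⟩ := x
  obtain ⟨c', ⟨f', _⟩, ⟨g', _⟩⟩ := y
  obtain rfl : c = c' := hc
  obtain rfl : f = f' := hf
  obtain rfl : g = g' := hg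
  rfl

/-- A colouring of a gluing amounts to compatible colourings of the two sides. -/
noncomputable def glueColoringEquiv (h : Function.Injective fun k => (t k, w k)) :
    (glue L H t w).lineGraph.Coloring (Fin 3) ≃
      Σ c : ι → Fin 3, {f // IsBoundaryColoring L t c f} × {g // IsBoundaryColoring H w c g} where
  toFun C := ⟨fun k => C (glueEdge L H t w (.inr (.inr k))),
    ⟨fun e => C (glueEdge L H t w (.inl e)), by
      refine ⟨fun x e e' hx hx' hne => ?_, fun k e hk => ?_, fun k l hkl hne => ?_⟩
      · exact lineGraph_coloring_ne C (x := .inl x) (by simpa [glueEdge] using hx)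
          (by simpa [glueEdge] using hx') (by simpa [(glueEdge_bijective h).1.eq_iff] using hne)
      · exact lineGraph_coloring_ne C (x := .inl (t k)) (by simpa [glueEdge] using hk)
          (by simp [glueEdge]) (by simp [(glueEdge_bijective h).1.eq_iff])
      · exact lineGraph_coloring_ne C (x := .inl (t k)) (by simp [glueEdge])
          (by simp [glueEdge, hkl]) (by simpa [(glueEdge_bijective h).1.eq_iff] using hne)⟩,
    ⟨fun e => C (glueEdge L H t w (.inr (.inl e))), by
      refine ⟨fun x e e' hx hx' hne => ?_, fun k e hk => ?_, fun k l hkl hne => ?_⟩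
      · exact lineGraph_coloring_ne C (x := .inr x) (by simpa [glueEdge] using hx)
          (by simpa [glueEdge] using hx') (by simpa [(glueEdge_bijective h).1.eq_iff] using hne)
      · exact lineGraph_coloring_ne C (x := .inr (w k)) (by simpa [glueEdge] using hk)
          (by simp [glueEdge]) (by simp [(glueEdge_bijective h).1.eq_iff])
      · exact lineGraph_coloring_ne C (x := .inr (w k)) (by simp [glueEdge])
          (by simp [glueEdge, hkl]) (by simpa [(glueEdge_bijective h).1.eq_iff] using hne)⟩⟩
  invFun x := Coloring.mk (fun e => Sum.elim x.2.1.1 (Sum.elim x.2.2.1 x.1)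
      ((Equiv.ofBijective _ (glueEdge_bijective h)).symm e)) (by
    obtain ⟨c, ⟨f, hf⟩, ⟨g, hg⟩⟩ := x
    intro e e' hee'
    obtain ⟨p, rfl⟩ := (Equiv.ofBijective _ (glueEdge_bijective (L := L) (H := H) h)).surjective e
    obtain ⟨q, rfl⟩ := (Equiv.ofBijective _ (glueEdge_bijective (L := L) (H := H) h)).surjective e'
    rw [Equiv.symm_apply_apply, Equiv.symm_apply_apply]
    obtain ⟨hne, z, hz, hz'⟩ := hee'
    replace hne : p ≠ q := fun hpq => hne (congrArg _ hpq)
    rcases p with e | e | k <;> rcases q with e' | e' | l <;> rcases z with a | b <;>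
      simp [glueEdge] at hz hz' <;> simp only [Sum.elim_inl, Sum.elim_inr]
    · exact hf.edge hz hz' (by simpa using hne)
    · subst hz'; exact hf.semiedge hz
    · exact hg.edge hz hz' (by simpa using hne)
    · subst hz'; exact hg.semiedge hz
    · subst hz; exact (hf.semiedge hz').symm
    · subst hz; exact (hg.semiedge hz').symm
    · exact hf.terminal (hz.symm.trans hz') (by simpa using hne)
    · exact hg.terminal (hz.symm.trans hz') (by simpa using hne))
  left_inv C := by
    refine RelHom.ext fun e => ?_
    obtain ⟨p, rfl⟩ := (Equiv.ofBijective _ (glueEdge_bijective h)).surjective e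
    change Sum.elim _ (Sum.elim _ _) ((Equiv.ofBijective _ (glueEdge_bijective h)).symm _) = _
    rw [Equiv.symm_apply_apply]
    rcases p with e | e | k <;> rfl
  right_inv x := by
    have key : ∀ p, (Equiv.ofBijective _ (glueEdge_bijective (L := L) (H := H) h)).symm
        (glueEdge L H t w p) = p := Equiv.ofBijective_symm_apply_apply _ _
    obtain ⟨c, ⟨f, hf⟩, ⟨g, hg⟩⟩ := x
    have hc : (fun k => Sum.elim f (Sum.elim g c)
        ((Equiv.ofBijective _ (glueEdge_bijective h)).symm
          (glueEdge L H t w (.inr (.inr k))))) = c := by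
      funext k; rw [key]; rfl
    have hf' : (fun e => Sum.elim f (Sum.elim g c)
        ((Equiv.ofBijective _ (glueEdge_bijective h)).symm
          (glueEdge L H t w (.inl e)))) = f := by
      funext k; rw [key]; rfl
    have hg' : (fun e => Sum.elim f (Sum.elim g c)
        ((Equiv.ofBijective _ (glueEdge_bijective h)).symm
          (glueEdge L H t w (.inr (.inl e))))) = g := by
      funext k; rw [key]; rfl
    exact sigma_coloring_ext hc hf' hg'

theorem colorCount_glue [Finite A] [Finite B] [Fintype ι] [DecidableEq ι]
    (h : Function.Injective fun k => (t k, w k)) :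
    colorCount (glue L H t w) = ∑ c, boundaryCount L t c * boundaryCount H w c := by
  rw [colorCount, Nat.card_congr (glueColoringEquiv h), Nat.card_sigma]
  exact Finset.sum_congr rfl fun c _ => Nat.card_prod _ _

end Glue

/-! ### Reducing an edge on one side of a gluing -/

section Reduction

variable {A B ι : Type*}

/-- Reducing an edge on one side of a gluing is the same as gluing the reduction, with every
semiedge at an end of `e` moved to the neighbour of that end which is not on `e`. -/
def reductionGlueIso (L : SimpleGraph A) (H : SimpleGraph B) (t : ι → A) (w : ι → B)
    (hw : Function.Injective w) (e : Sym2 B) (w' : ι → {x // x ∉ e})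
    (hw' : ∀ k, w k ∉ e → (w' k : B) = w k)
    (hwe : ∀ k, w k ∈ e → ∀ z, z ∉ e → (H.Adj (w k) z ↔ z = w' k)) :
    reduction (glue L H t w) (e.map Sum.inr) ≃g glue L (reduction H e) t w' := by
  refine RelIso.symm
    { toFun := Sum.elim (fun a => ⟨.inl a, by simp⟩) (fun b => ⟨.inr b.1, by simpa using b.2⟩)
      invFun := fun z => match z with
        | ⟨.inl a, _⟩ => .inl a
        | ⟨.inr b, h⟩ => .inr ⟨b, by simpa using h⟩
      left_inv := by rintro (a | b) <;> rfl
      right_inv := by rintro ⟨a | b, h⟩ <;> rfl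
      map_rel_iff' := ?_ }
  have cross : ∀ (a : A) (b : {x // x ∉ e}), ((∃ k, t k = a ∧ w k = b) ∨
      ∃ u ∈ e, (∃ k, t k = a ∧ w k = u) ∧ H.Adj u b) ↔ ∃ k, t k = a ∧ w' k = b := by
    intro a b
    constructor
    · rintro (⟨k, rfl, hk⟩ | ⟨u, hu, ⟨k, rfl, rfl⟩, hub⟩)
      · exact ⟨k, rfl, Subtype.ext ((hw' k (hk ▸ b.2)).trans hk)⟩
      · exact ⟨k, rfl, Subtype.ext ((hwe k hu b b.2).1 hub).symm⟩
    · rintro ⟨k, rfl, rfl⟩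
      by_cases hk : w k ∈ e
      · exact .inr ⟨w k, hk, ⟨k, rfl, rfl⟩, (hwe k hk _ (w' k).2).2 rfl⟩
      · exact .inl ⟨k, rfl, (hw' k hk).symm⟩
  rintro (a | b) (a' | b')
  · simp only [Equiv.coe_fn_mk, Sum.elim_inl, glue_adj_inl_inl, reduction]
    constructor
    · rintro ⟨hne, h | ⟨u, hu, h, h'⟩⟩
      · exact h
      -- Two distinct vertices of `A` joined through an end of `e` would need two semiedges at that
      -- end, which injectivity of `w` excludes; so the reduction creates no edge within `A`.
      · obtain ⟨u, hu, rfl⟩ := Sym2.mem_map.1 hu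
        obtain ⟨k, rfl, hk⟩ := glue_adj_inr_inl.1 h
        obtain ⟨l, rfl, hl⟩ := glue_adj_inr_inl.1 h'
        obtain rfl := hw (hk.trans hl.symm)
        exact absurd rfl hne
    · intro h
      exact ⟨fun h' => h.ne (by simpa using h'), .inl h⟩
  · simp [reduction, ← cross]
  · simp [reduction, ← cross, and_comm]
  · simp [reduction, Subtype.ext_iff]

end Reduction

/-! ### Parity and Kempe chains in graphs with semiedges -/

section Kempe

variable {A ι : Type*} {L : SimpleGraph A} {t : ι → A} {c : ι → Fin 3} {f : L.edgeSet → Fin 3}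
  {a b : Fin 3}

/-- The spanning subgraph formed by the edges of colours `a` and `b`. -/
def twoColorGraph (f : L.edgeSet → Fin 3) (a b : Fin 3) : SimpleGraph A where
  Adj x y := ∃ h : L.Adj x y, f ⟨s(x, y), h⟩ = a ∨ f ⟨s(x, y), h⟩ = b
  symm := ⟨by
    rintro x y ⟨h, hf⟩
    have : (⟨s(y, x), h.symm⟩ : L.edgeSet) = ⟨s(x, y), h⟩ := Subtype.ext Sym2.eq_swap
    exact ⟨h.symm, by rwa [this]⟩⟩
  loopless := ⟨fun _ h => h.1.ne rfl⟩

/-- Every vertex of `L` is on three edges and semiedges. -/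
def IsCubicAt (L : SimpleGraph A) (t : ι → A) : Prop :=
  ∀ x, Nat.card (L.neighborSet x ⊕ {k // t k = x}) = 3

-- The three edges and semiedges at `x` carry three different colours, so exactly one has colour `a`
-- and exactly one has colour `b`.
open Classical in
theorem IsBoundaryColoring.degree_add [Fintype ι] [Fintype A] (hL : IsCubicAt L t)
    (h : IsBoundaryColoring L t c f) (hab : a ≠ b) (x : A) :
    (twoColorGraph f a b).degree x +
      (Finset.univ.filter fun k => t k = x ∧ (c k = a ∨ c k = b)).card = 2 := by
  let s : L.neighborSet x ⊕ {k // t k = x} → Fin 3 :=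
    Sum.elim (fun y => f ⟨s(x, y.1), y.2⟩) fun k => c k.1
  have hs : Function.Injective s := by
    rintro (⟨y, hy⟩ | ⟨k, hk⟩) (⟨z, hz⟩ | ⟨l, hl⟩) heq
    · by_contra hne
      refine h.edge (x := x) (e := ⟨s(x, y), hy⟩) (e' := ⟨s(x, z), hz⟩) (by simp) (by simp) ?_ heq
      intro h
      refine hne ?_
      have : y = z := Sym2.congr_right.1 (congrArg Subtype.val h)
      subst this
      rfl
    · exact absurd heq (h.semiedge (k := l) (e := ⟨s(x, y), hy⟩) (by simp [hl]))
    · exact absurd heq.symm (h.semiedge (k := k) (e := ⟨s(x, z), hz⟩) (by simp [hk]))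
    · by_contra hne
      refine h.terminal (k := k) (l := l) (hk.trans hl.symm) ?_ heq
      rintro rfl
      exact hne rfl
  have hs' : Function.Bijective s := by
    rw [Nat.bijective_iff_injective_and_card]
    exact ⟨hs, by rw [hL x, Nat.card_fin]⟩
  have h2 : Nat.card {z // s z = a ∨ s z = b} = 2 := by
    have e : {z // s z = a ∨ s z = b} ≃ {i // i = a ∨ i = b} :=
      (Equiv.ofBijective s hs').subtypeEquiv fun z => Iff.rfl
    rw [Nat.card_congr e, Nat.card_eq_fintype_card]
    clear * - hab
    revert a b
    decide
  rw [Nat.card_congr (Equiv.subtypeSum (p := fun z => s z = a ∨ s z = b)), Nat.card_sum] at h2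
  rw [← h2, ← card_neighborSet_eq_degree, ← Nat.card_eq_fintype_card, ← Fintype.card_subtype,
    ← Nat.card_eq_fintype_card]
  congr 1
  · refine Nat.card_congr
      { toFun := fun y => ⟨⟨y.1, y.2.1⟩, y.2.2⟩
        invFun := fun y => ⟨y.1.1, y.1.2, y.2⟩
        left_inv := fun _ => rfl
        right_inv := fun _ => rfl }
  · exact Nat.card_congr (Equiv.subtypeSubtypeEquivSubtypeInter _ _).symm

-- Sum `degree_add` over all vertices: the degrees contribute twice the number of two-coloured edges
-- and the right-hand sides are 2, so the number of two-coloured semiedges is even.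
open Classical in
theorem IsBoundaryColoring.even_card [Fintype ι] [Finite A] (hL : IsCubicAt L t)
    (h : IsBoundaryColoring L t c f) (hab : a ≠ b) :
    Even (Finset.univ.filter fun k => c k = a ∨ c k = b).card := by
  have := Fintype.ofFinite A
  have h1 := Finset.sum_congr (rfl : (Finset.univ : Finset A) = _)
    fun x _ => h.degree_add hL hab x
  rw [Finset.sum_add_distrib, sum_degrees_eq_twice_card_edges, Finset.sum_const] at h1
  have h2 := Finset.card_eq_sum_card_fiberwise (f := t)
    (s := Finset.univ.filter fun k => c k = a ∨ c k = b) (t := Finset.univ) (by simp)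
  simp only [Finset.filter_filter] at h2
  simp only [and_comm (a := t _ = _)] at h1
  rw [← h2, smul_eq_mul] at h1
  rw [Nat.even_iff]
  omega

open Classical in
/-- A Kempe chain that has an end at a semiedge has exactly two such ends. -/
theorem IsBoundaryColoring.card_ends [Fintype ι] [Finite A] (hL : IsCubicAt L t)
    (h : IsBoundaryColoring L t c f) (hab : a ≠ b) {k₀ : ι} (hk₀ : c k₀ = a ∨ c k₀ = b) :
    (Finset.univ.filter fun k => (twoColorGraph f a b).Reachable (t k₀) (t k) ∧
      (c k = a ∨ c k = b)).card = 2 := by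
  set E := Finset.univ.filter fun k => (twoColorGraph f a b).Reachable (t k₀) (t k) ∧
    (c k = a ∨ c k = b) with hE
  have := Fintype.ofFinite A
  set Q := twoColorGraph f a b with hQ
  set C := Q.connectedComponentMk (t k₀)
  have hC : ∀ x, x ∈ C ↔ Q.Reachable (t k₀) x := fun x => by
    change Q.connectedComponentMk x = Q.connectedComponentMk (t k₀) ↔ _
    rw [ConnectedComponent.eq, reachable_comm]
  have hdeg : ∀ x : C, C.toSimpleGraph.degree x = Q.degree x := by
    intro x
    rw [← card_neighborSet_eq_degree, ← card_neighborSet_eq_degree]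
    exact Fintype.card_congr
      { toFun := fun y => ⟨y.1.1, y.2⟩
        invFun := fun y => ⟨⟨y.1, C.mem_supp_of_adj_mem_supp x.2 y.2⟩, y.2⟩
        left_inv := fun _ => rfl
        right_inv := fun _ => rfl }
  have h1 := Finset.sum_congr (rfl : (Finset.univ : Finset C) = _)
    fun x _ => h.degree_add hL hab x.1
  rw [Finset.sum_add_distrib, ← Finset.sum_congr rfl fun x _ => hdeg x,
    sum_degrees_eq_twice_card_edges, Finset.sum_const, smul_eq_mul] at h1
  have h2 : E.card =
      ∑ x : C, (Finset.univ.filter fun k => t k = x.1 ∧ (c k = a ∨ c k = b)).card := by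
    rw [← Finset.card_biUnion]
    · congr 1
      ext k
      simp [hE, ← hC]
    · intro x _ y _ hxy
      rw [Function.onFun, Finset.disjoint_left]
      intro k hk hk'
      simp only [Finset.mem_filter, Finset.mem_univ, true_and] at hk hk'
      exact hxy (Subtype.ext (hk.1.symm.trans hk'.1))
  rw [← h2] at h1
  -- By `h1`, the number of ends is 2(|V| - |E|) for the component, hence even; connectedness bounds
  -- it by 2, and `k₀` makes it positive.
  have h3 := C.connected_toSimpleGraph.card_vert_le_card_edgeSet_add_one
  have h4 : 0 < E.card := Finset.card_pos.2 ⟨k₀, by simp [hE, hk₀]⟩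
  rw [Finset.card_univ, edgeFinset_card, ← Nat.card_eq_fintype_card, ← Nat.card_eq_fintype_card] at h1
  omega

open Classical in
/-- Exchange the colours `a` and `b` on the edges that meet `S`. -/
noncomputable def swapOn (a b : Fin 3) (S : Set A) (f : L.edgeSet → Fin 3) : L.edgeSet → Fin 3 :=
  fun e => if ∃ x ∈ S, x ∈ e.1 then Equiv.swap a b (f e) else f e

theorem swapOn_swapOn (S : Set A) : swapOn a b S (swapOn a b S f) = f := by
  funext e
  by_cases h : ∃ x ∈ S, x ∈ e.1 <;> simp only [swapOn, if_pos, if_neg, h, not_false_eq_true]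
  simp

theorem swap_eq_or_eq_iff (a b i : Fin 3) :
    (Equiv.swap a b i = a ∨ Equiv.swap a b i = b) ↔ (i = a ∨ i = b) := by
  revert a b i
  decide

theorem twoColorGraph_swapOn (S : Set A) :
    twoColorGraph (swapOn a b S f) a b = twoColorGraph f a b := by
  ext x y
  refine exists_congr fun h => ?_
  unfold swapOn
  split_ifs
  · exact swap_eq_or_eq_iff a b _
  · rfl

-- As `S` is a union of components of the two-coloured graph, an edge leaving `S` has the third
-- colour and is fixed by the swap. So at each vertex either all colours are swapped or none is.
open Classical in
theorem IsBoundaryColoring.swapOn (h : IsBoundaryColoring L t c f) {S : Set A}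
    (hS : ∀ x y, x ∈ S → (twoColorGraph f a b).Adj x y → y ∈ S) :
    IsBoundaryColoring L t (fun k => if t k ∈ S then Equiv.swap a b (c k) else c k)
      (swapOn a b S f) := by
  have hf : ∀ x, ∀ e : L.edgeSet, x ∈ e.1 →
      Snark.swapOn a b S f e = if x ∈ S then Equiv.swap a b (f e) else f e := by
    rintro x ⟨e, he⟩ hx
    obtain ⟨y, rfl⟩ := Sym2.mem_iff_exists.1 hx
    by_cases hxS : x ∈ S
    · rw [if_pos hxS, Snark.swapOn, if_pos ⟨x, hxS, hx⟩]
    · rw [if_neg hxS, Snark.swapOn]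
      split_ifs with hy
      · obtain ⟨z, hz, hz'⟩ := hy
        obtain rfl | rfl := Sym2.mem_iff.1 hz'
        · exact absurd hz hxS
        · refine Equiv.swap_apply_of_ne_of_ne ?_ ?_ <;> intro hf
          · exact hxS (hS _ x hz (Adj.symm ⟨he, .inl hf⟩))
          · exact hxS (hS _ x hz (Adj.symm ⟨he, .inr hf⟩))
      · rfl
  refine ⟨fun x e e' hx hx' hne => ?_, fun k e hk => ?_, fun k l hkl hne => ?_⟩
  · rw [hf x e hx, hf x e' hx']
    split_ifs
    · exact (Equiv.swap a b).injective.ne (h.edge hx hx' hne)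
    · exact h.edge hx hx' hne
  · rw [hf _ e hk]
    split_ifs
    · exact (Equiv.swap a b).injective.ne (h.semiedge hk)
    · exact h.semiedge hk
  · rw [hkl]
    split_ifs
    · exact (Equiv.swap a b).injective.ne (h.terminal hkl hne)
    · exact h.terminal hkl hne

theorem boundaryCount_eq_zero_iff [Finite A] : boundaryCount L t c = 0 ↔
    ∀ f, ¬ IsBoundaryColoring L t c f := by
  rw [boundaryCount, Finite.card_eq_zero_iff, isEmpty_subtype]

/-- Permuting the colours. -/
theorem boundaryCount_comp_equiv (σ : Fin 3 ≃ Fin 3) :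
    boundaryCount L t (σ ∘ c) = boundaryCount L t c := by
  refine (Nat.card_congr ((Equiv.arrowCongr (Equiv.refl _) σ).subtypeEquiv fun f => ?_)).symm
  constructor
  · exact fun h => ⟨fun x e e' hx hx' hne => σ.injective.ne (h.edge hx hx' hne),
      fun k e hk => σ.injective.ne (h.semiedge hk),
      fun k l hkl hne => σ.injective.ne (h.terminal hkl hne)⟩
  · exact fun h => ⟨fun x e e' hx hx' hne => σ.injective.ne_iff.1 (h.edge hx hx' hne),
      fun k e hk => σ.injective.ne_iff.1 (h.semiedge hk),
      fun k l hkl hne => σ.injective.ne_iff.1 (h.terminal hkl hne)⟩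

/-- If switching a Kempe chain that starts at the semiedge `k₀` can only lead to the boundary
colours `c'`, then there are at least as many colourings for `c'` as for `c`. -/
theorem boundaryCount_le_of_kempe [Finite ι] [DecidableEq ι] [Finite A] (hL : IsCubicAt L t)
    (hab : a ≠ b) {k₀ : ι} (hk₀ : c k₀ = a ∨ c k₀ = b) {c' : ι → Fin 3}
    (hc' : ∀ k₁, k₁ ≠ k₀ → (c k₁ = a ∨ c k₁ = b) →
      (fun k => if k = k₀ ∨ k = k₁ then Equiv.swap a b (c k) else c k) = c' ∨
      boundaryCount L t (fun k => if k = k₀ ∨ k = k₁ then Equiv.swap a b (c k) else c k) = 0) :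
    boundaryCount L t c ≤ boundaryCount L t c' := by
  classical
  have := Fintype.ofFinite ι
  have key : ∀ f, IsBoundaryColoring L t c f → IsBoundaryColoring L t c'
      (swapOn a b {x | (twoColorGraph f a b).Reachable (t k₀) x} f) := by
    intro f hf
    have hsw := hf.swapOn (a := a) (b := b) (S := {x | (twoColorGraph f a b).Reachable (t k₀) x})
      fun x y hx hxy => Reachable.trans hx hxy.reachable
    obtain ⟨k₁, hk₁, hends⟩ : ∃ k₁, k₁ ≠ k₀ ∧ (Finset.univ.filter fun k =>
        (twoColorGraph f a b).Reachable (t k₀) (t k) ∧ (c k = a ∨ c k = b)) = {k₀, k₁} := by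
      obtain ⟨x, y, hxy, hends⟩ := Finset.card_eq_two.1 (hf.card_ends hL hab hk₀)
      have : k₀ ∈ ({x, y} : Finset ι) := hends ▸ by simp [hk₀]
      rcases Finset.mem_insert.1 this with rfl | h
      · exact ⟨y, hxy.symm, hends⟩
      · obtain rfl := Finset.mem_singleton.1 h
        exact ⟨x, hxy, hends.trans (Finset.pair_comm _ _)⟩
    have hmem : ∀ k, ((twoColorGraph f a b).Reachable (t k₀) (t k) ∧ (c k = a ∨ c k = b)) ↔
        (k = k₀ ∨ k = k₁) := fun k => by
      simpa using Finset.ext_iff.1 hends k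
    have heq : (fun k => if t k ∈ {x | (twoColorGraph f a b).Reachable (t k₀) x} then
        Equiv.swap a b (c k) else c k) =
        fun k => if k = k₀ ∨ k = k₁ then Equiv.swap a b (c k) else c k := by
      funext k
      by_cases hk : k = k₀ ∨ k = k₁
      · rw [if_pos hk, if_pos (Set.mem_ofPred.2 ((hmem k).2 hk).1)]
      · rw [if_neg hk]
        split_ifs with hr
        · have : ¬ (c k = a ∨ c k = b) := fun h => hk ((hmem k).1 ⟨hr, h⟩)
          exact Equiv.swap_apply_of_ne_of_ne (fun h => this (.inl h)) fun h => this (.inr h)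
        · rfl
    rw [heq] at hsw
    rcases hc' k₁ hk₁ ((hmem k₁).2 (.inr rfl)).2 with h | h
    · rwa [h] at hsw
    · exact absurd hsw (boundaryCount_eq_zero_iff.1 h _)
  -- The switch is injective: it does not change the two-coloured graph, so the chain can be read
  -- off from the result and switched back.
  exact Nat.card_le_card_of_injective (fun f => ⟨_, key f.1 f.2⟩) (by
    rintro ⟨f, hf⟩ ⟨g, hg⟩ hfg
    have hfg : swapOn a b {x | (twoColorGraph f a b).Reachable (t k₀) x} f =
      swapOn a b {x | (twoColorGraph g a b).Reachable (t k₀) x} g := congrArg Subtype.val hfg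
    have hQ : twoColorGraph f a b = twoColorGraph g a b := by
      rw [← twoColorGraph_swapOn (f := f), hfg, twoColorGraph_swapOn]
    rw [hQ] at hfg
    have := congrArg (swapOn a b {x | (twoColorGraph g a b).Reachable (t k₀) x}) hfg
    rw [swapOn_swapOn, swapOn_swapOn] at this
    exact SetCoe.ext this)

end Kempe

/-! ### Boundary patterns on five semiedges -/

section Patterns

/-- Three colours agree, the two others differ from them and from each other. -/
def IsSplit (a b x y z : Fin 3) : Prop := x = y ∧ x = z ∧ a ≠ b ∧ a ≠ x ∧ b ≠ x

instance (a b x y z : Fin 3) : Decidable (IsSplit a b x y z) :=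
  inferInstanceAs (Decidable (x = y ∧ x = z ∧ a ≠ b ∧ a ≠ x ∧ b ≠ x))

/-- Three consecutive colours agree, and the two others differ from them and from each other. -/
def IsNear (c : ZMod 5 → Fin 3) : Prop :=
  ∃ i, IsSplit (c i) (c (i + 1)) (c (i + 2)) (c (i + 3)) (c (i + 4))

/-- Three colours agree, the two others differ from them and from each other and are not
consecutive. -/
def IsFar (c : ZMod 5 → Fin 3) : Prop :=
  ∃ i, IsSplit (c i) (c (i + 2)) (c (i + 1)) (c (i + 3)) (c (i + 4))

theorem exists_zmod_five {p : ZMod 5 → Prop} : (∃ i, p i) ↔ p 0 ∨ p 1 ∨ p 2 ∨ p 3 ∨ p 4 := by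
  constructor
  · rintro ⟨i, hi⟩
    have : ∀ i : ZMod 5, i = 0 ∨ i = 1 ∨ i = 2 ∨ i = 3 ∨ i = 4 := by decide
    rcases this i with rfl | rfl | rfl | rfl | rfl <;> simp [hi]
  · rintro (h | h | h | h | h) <;> exact ⟨_, h⟩

theorem forall_zmod_five {p : ZMod 5 → Prop} : (∀ i, p i) ↔ p 0 ∧ p 1 ∧ p 2 ∧ p 3 ∧ p 4 := by
  have h := not_congr (exists_zmod_five (p := fun i => ¬ p i))
  push Not at h
  exact h

/-- `IsNear` in terms of the five values, which is faster to decide. -/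
def IsNearTuple (a b c d e : Fin 3) : Prop :=
  IsSplit a b c d e ∨ IsSplit b c d e a ∨ IsSplit c d e a b ∨ IsSplit d e a b c ∨ IsSplit e a b c d

/-- `IsFar` in terms of the five values, which is faster to decide. -/
def IsFarTuple (a b c d e : Fin 3) : Prop :=
  IsSplit a c b d e ∨ IsSplit b d c e a ∨ IsSplit c e d a b ∨ IsSplit d a e b c ∨ IsSplit e b a c d

instance (a b c d e : Fin 3) : Decidable (IsNearTuple a b c d e) :=
  inferInstanceAs (Decidable (IsSplit a b c d e ∨ IsSplit b c d e a ∨ IsSplit c d e a b ∨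
    IsSplit d e a b c ∨ IsSplit e a b c d))

instance (a b c d e : Fin 3) : Decidable (IsFarTuple a b c d e) :=
  inferInstanceAs (Decidable (IsSplit a c b d e ∨ IsSplit b d c e a ∨ IsSplit c e d a b ∨
    IsSplit d a e b c ∨ IsSplit e b a c d))

theorem isNearTuple_iff (c : ZMod 5 → Fin 3) :
    IsNearTuple (c 0) (c 1) (c 2) (c 3) (c 4) ↔ IsNear c :=
  (exists_zmod_five (p := fun i => IsSplit (c i) (c (i + 1)) (c (i + 2)) (c (i + 3)) (c (i + 4)))).symm

theorem isFarTuple_iff (c : ZMod 5 → Fin 3) :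
    IsFarTuple (c 0) (c 1) (c 2) (c 3) (c 4) ↔ IsFar c :=
  (exists_zmod_five (p := fun i => IsSplit (c i) (c (i + 2)) (c (i + 1)) (c (i + 3)) (c (i + 4)))).symm

instance : DecidablePred IsNear := fun c => decidable_of_iff _ (isNearTuple_iff c)

instance : DecidablePred IsFar := fun c => decidable_of_iff _ (isFarTuple_iff c)

/-- Colour `a` at `i`, colour `b` at `i + 2`, and colour `d` elsewhere. -/
def farPattern (i : ZMod 5) (a b d : Fin 3) (k : ZMod 5) : Fin 3 :=
  if k = i then a else if k = i + 2 then b else d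

theorem IsFar.exists_eq {c : ZMod 5 → Fin 3} (h : IsFar c) :
    ∃ i, ∃ σ : Fin 3 ≃ Fin 3, c = σ ∘ farPattern i 0 1 2 := by
  obtain ⟨i, h4, h5, h1, h2, h3⟩ := h
  replace h4 := h4.symm
  replace h5 := h5.symm
  have hb : Function.Bijective ![c i, c (i + 2), c (i + 1)] := by
    rw [← Finite.injective_iff_bijective]
    intro x y
    fin_cases x <;> fin_cases y <;> simp [h1, h2, h3, h1.symm, h2.symm, h3.symm]
  refine ⟨i, Equiv.ofBijective _ hb, funext fun k => ?_⟩
  have hk : ∀ i k : ZMod 5, k = i ∨ k = i + 1 ∨ k = i + 2 ∨ k = i + 3 ∨ k = i + 4 := by decide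
  have hne : ∀ i : ZMod 5, i + 1 ≠ i ∧ i + 2 ≠ i ∧ i + 3 ≠ i ∧ i + 4 ≠ i ∧ i + 1 ≠ i + 2 ∧
    i + 3 ≠ i + 2 ∧ i + 4 ≠ i + 2 := by decide
  obtain ⟨n1, n2, n3, n4, n5, n6, n7⟩ := hne i
  rcases hk i k with rfl | rfl | rfl | rfl | rfl <;> simp only [Function.comp_apply, farPattern]
  · simp
  · rw [if_neg n1, if_neg n5]; rfl
  · simp only [if_neg n2, if_true]; rfl
  · rw [if_neg n3, if_neg n6, h4]; rfl
  · rw [if_neg n4, if_neg n7, h5]; rfl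

/-- The hypothesis gives the three colours multiplicities of equal parity. They add up to 5, so all
are odd, and each colour must occur or its multiplicity would be 0: the multiplicities are 3, 1, 1.
-/
theorem isNear_or_isFar (c : ZMod 5 → Fin 3)
    (h : ∀ a b, a ≠ b → Even (Finset.univ.filter fun k => c k = a ∨ c k = b).card) :
    IsNear c ∨ IsFar c := by
  have key : ∀ a b, (Finset.univ.filter fun k => c k = a ∨ c k = b).card =
      (if c 0 = a ∨ c 0 = b then 1 else 0) + (if c 1 = a ∨ c 1 = b then 1 else 0) +
      (if c 2 = a ∨ c 2 = b then 1 else 0) + (if c 3 = a ∨ c 3 = b then 1 else 0) +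
      (if c 4 = a ∨ c 4 = b then 1 else 0) := fun a b => by
    rw [Finset.card_filter]
    exact Fin.sum_univ_five _
  simp only [key] at h
  rw [← isNearTuple_iff, ← isFarTuple_iff]
  have h01 := h 0 1 (by decide)
  have h02 := h 0 2 (by decide)
  clear h key
  revert h01 h02
  generalize c 0 = v, c 1 = w, c 2 = x, c 3 = y, c 4 = z
  revert v w x y z
  decide +kernel

/-- Multiplying by 2 or by its inverse 3 takes index differences ±1 to ±2 and ±2 to ±1. -/
theorem isFar_comp_two (c : ZMod 5 → Fin 3) : IsFar (fun k => c (2 * k)) ↔ IsNear c := by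
  rw [← isNearTuple_iff, ← isFarTuple_iff]
  change IsFarTuple (c 0) (c 2) (c 4) (c 1) (c 3) ↔ _
  generalize c 0 = v, c 1 = w, c 2 = x, c 3 = y, c 4 = z
  revert v w x y z
  decide +kernel

theorem isFar_comp_three (c : ZMod 5 → Fin 3) : IsFar (fun k => c (3 * k)) ↔ IsNear c := by
  rw [← isNearTuple_iff, ← isFarTuple_iff]
  change IsFarTuple (c 0) (c 3) (c 1) (c 4) (c 2) ↔ _
  generalize c 0 = v, c 1 = w, c 2 = x, c 3 = y, c 4 = z
  revert v w x y z
  decide +kernel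

/-- The chain from `i` ends at `i + 1`, `i + 3` or `i + 4`. The first two put colour 0 next to the
colour 1 at `i + 2`, a near pattern; only `i + 4` gives a far one. -/
theorem kempe_farPattern (i k₁ : ZMod 5) (hk : k₁ ≠ i)
    (h : farPattern i 0 1 2 k₁ = 0 ∨ farPattern i 0 1 2 k₁ = 2) :
    (fun k => if k = i ∨ k = k₁ then Equiv.swap 0 2 (farPattern i 0 1 2 k)
      else farPattern i 0 1 2 k) = farPattern (i + 2) 1 0 2 ∨
    IsNear (fun k => if k = i ∨ k = k₁ then Equiv.swap 0 2 (farPattern i 0 1 2 k)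
      else farPattern i 0 1 2 k) := by
  revert i k₁; decide +kernel

variable {A : Type*} [Finite A] {L : SimpleGraph A} {t : ZMod 5 → A}

theorem boundaryCount_farPattern_le (hL : IsCubicAt L t)
    (hnear : ∀ c, IsNear c → boundaryCount L t c = 0) (i : ZMod 5) :
    boundaryCount L t (farPattern i 0 1 2) ≤ boundaryCount L t (farPattern (i + 2) 0 1 2) := by
  have h : boundaryCount L t (farPattern i 0 1 2) ≤
      boundaryCount L t (farPattern (i + 2) 1 0 2) :=
    boundaryCount_le_of_kempe hL (a := 0) (b := 2) (by decide) (k₀ := i)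
      (.inl (by simp [farPattern])) fun k₁ hk h =>
        (kempe_farPattern i k₁ hk h).imp_right (hnear _)
  have hσ : farPattern (i + 2) 1 0 2 = Equiv.swap 0 1 ∘ farPattern (i + 2) 0 1 2 := by
    clear * -
    revert i; decide +kernel
  rwa [hσ, boundaryCount_comp_equiv] at h

/-- If no near pattern occurs on the boundary, then exactly the far patterns occur, all of them in
the same number of colourings. -/
theorem boundaryCount_eq_ite (hL : IsCubicAt L t)
    (hnear : ∀ c, IsNear c → boundaryCount L t c = 0) (c : ZMod 5 → Fin 3) :
    boundaryCount L t c = if IsFar c then boundaryCount L t (farPattern 0 0 1 2) else 0 := by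
  split_ifs with hc
  · obtain ⟨i, σ, rfl⟩ := hc.exists_eq
    rw [boundaryCount_comp_equiv]
    have hle := boundaryCount_farPattern_le hL hnear
    have key : ∀ i, boundaryCount L t (farPattern i 0 1 2) ≤
        boundaryCount L t (farPattern (i + 1) 0 1 2) := by
      intro i
      -- Three shifts by 2 are a shift by 1 modulo 5. The inequalities thus run around a cycle and
      -- are all equalities.
      have h3 := ((hle i).trans (hle (i + 2))).trans (hle (i + 2 + 2))
      rwa [show i + 2 + 2 + 2 = i + 1 by clear * -; revert i; decide] at h3
    have key' : ∀ i (n : ℕ), boundaryCount L t (farPattern i 0 1 2) ≤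
        boundaryCount L t (farPattern (i + n) 0 1 2) := by
      intro i n
      induction n with
      | zero => simp
      | succ n ih => exact ih.trans (by simpa [add_assoc] using key (i + n))
    apply le_antisymm
    · simpa using key' i (-i).val
    · simpa using key' 0 i.val
  · by_contra h0
    rw [boundaryCount_eq_zero_iff] at h0
    push Not at h0
    obtain ⟨f, hf⟩ := h0
    rcases isNear_or_isFar c fun a b hab => (by
        convert hf.even_card hL hab) with h | h
    · exact boundaryCount_eq_zero_iff.1 (hnear c h) f hf
    · exact hc h

set_option synthInstance.maxSize 1000 in
theorem isNear_of_pentagon_coloring {c g : ZMod 5 → Fin 3}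
    (h : ∀ k, g k ≠ g (k + 1) ∧ g k ≠ c k ∧ g k ≠ c (k + 1)) : IsNear c := by
  rw [forall_zmod_five] at h
  change (g 0 ≠ g 1 ∧ g 0 ≠ c 0 ∧ g 0 ≠ c 1) ∧ (g 1 ≠ g 2 ∧ g 1 ≠ c 1 ∧ g 1 ≠ c 2) ∧
    (g 2 ≠ g 3 ∧ g 2 ≠ c 2 ∧ g 2 ≠ c 3) ∧ (g 3 ≠ g 4 ∧ g 3 ≠ c 3 ∧ g 3 ≠ c 4) ∧
    (g 4 ≠ g 0 ∧ g 4 ≠ c 4 ∧ g 4 ≠ c 0) at h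
  rw [← isNearTuple_iff]
  -- Hypotheses are interleaved with the quantifiers so that the case check discards bad branches
  -- early.
  have key : ∀ g0 g1, g0 ≠ g1 → ∀ c1, g0 ≠ c1 ∧ g1 ≠ c1 → ∀ g2, g1 ≠ g2 →
      ∀ c2, g1 ≠ c2 ∧ g2 ≠ c2 → ∀ g3, g2 ≠ g3 → ∀ c3, g2 ≠ c3 ∧ g3 ≠ c3 →
      ∀ g4, g3 ≠ g4 ∧ g4 ≠ g0 → ∀ c4, g3 ≠ c4 ∧ g4 ≠ c4 → ∀ c0, g4 ≠ c0 ∧ g0 ≠ c0 →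
      IsNearTuple c0 c1 c2 c3 c4 := by decide +kernel
  obtain ⟨⟨h1, h2, h3⟩, ⟨h4, h5, h6⟩, ⟨h7, h8, h9⟩, ⟨h10, h11, h12⟩, h13, h14, h15⟩ := h
  exact key _ _ h1 _ ⟨h3, h5⟩ _ h4 _ ⟨h6, h8⟩ _ h7 _ ⟨h9, h11⟩ _ ⟨h10, h13⟩ _ ⟨h12, h14⟩ _
    ⟨h15, h2⟩

/-- Here `g k` colours the edge from `k` to `k + 1`. The edges `i`, `i + 1` and `i + 4` each meet
semiedges of two different colours and are forced; the other two then follow around the pentagon. -/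
theorem IsNear.existsUnique_pentagon_coloring {c : ZMod 5 → Fin 3} (h : IsNear c) :
    ∃! g : ZMod 5 → Fin 3, ∀ k, g k ≠ g (k + 1) ∧ g k ≠ c k ∧ g k ≠ c (k + 1) := by
  obtain ⟨i, h4, h5, h1, h2, h3⟩ := h
  replace h4 := h4.symm
  replace h5 := h5.symm
  have hi : ∀ i : ZMod 5, i + 1 + 1 = i + 2 ∧ i + 2 + 1 = i + 3 ∧ i + 3 + 1 = i + 4 ∧
    i + 4 + 1 = i := by decide
  have hne : ∀ i : ZMod 5, i + 1 ≠ i ∧ i + 2 ≠ i ∧ i + 3 ≠ i ∧ i + 4 ≠ i ∧ i + 2 ≠ i + 1 ∧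
    i + 3 ≠ i + 1 ∧ i + 4 ≠ i + 1 ∧ i + 3 ≠ i + 2 ∧ i + 4 ≠ i + 2 ∧ i + 4 ≠ i + 3 := by decide
  have hk : ∀ i k : ZMod 5, k = i ∨ k = i + 1 ∨ k = i + 2 ∨ k = i + 3 ∨ k = i + 4 := by decide
  obtain ⟨e1, e2, e3, e4⟩ := hi i
  have hne' := hne i
  have third' : ∀ a b d x : Fin 3, a ≠ b ∧ a ≠ d ∧ b ≠ d ∧ x ≠ a ∧ x ≠ b → x = d := by
    decide +kernel
  have third : ∀ a b d x : Fin 3, a ≠ b → a ≠ d → b ≠ d → x ≠ a → x ≠ b → x = d :=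
    fun a b d x h1 h2 h3 h4 h5 => third' a b d x ⟨h1, h2, h3, h4, h5⟩
  refine ⟨fun k => if k = i then c (i + 2) else if k = i + 1 ∨ k = i + 3 then c i
    else c (i + 1), fun k => ?_, fun g hg => funext fun k => ?_⟩
  · rcases hk i k with rfl | rfl | rfl | rfl | rfl <;> grind
  · have g0 : g i = c (i + 2) := third _ _ _ _ h1 h2 h3 (hg i).2.1 (hg i).2.2
    have g1 : g (i + 1) = c i := third _ _ _ _ h3 h1.symm h2.symm (hg (i + 1)).2.1
      (e1 ▸ (hg (i + 1)).2.2)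
    have g4 : g (i + 4) = c (i + 1) := third _ _ _ _ h2.symm h3.symm h1
      (h5 ▸ (hg (i + 4)).2.1) fun h => (hg (i + 4)).2.2 (h.trans (congrArg c e4.symm))
    have g2 : g (i + 2) = c (i + 1) := third _ _ _ _ h2 h1 h3.symm
      (g1 ▸ e1 ▸ (hg (i + 1)).1.symm) (hg (i + 2)).2.1
    have g3 : g (i + 3) = c i := third _ _ _ _ h3 h1.symm h2.symm
      (g2 ▸ e2 ▸ (hg (i + 2)).1.symm) (h4 ▸ (hg (i + 3)).2.1)
    rcases hk i k with rfl | rfl | rfl | rfl | rfl <;> grind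

theorem card_pentagon_colorings (c : ZMod 5 → Fin 3) :
    Fintype.card {g : ZMod 5 → Fin 3 // ∀ k, g k ≠ g (k + 1) ∧ g k ≠ c k ∧ g k ≠ c (k + 1)} =
      if IsNear c then 1 else 0 := by
  split_ifs with h
  · obtain ⟨g, hg, hu⟩ := h.existsUnique_pentagon_coloring
    exact Fintype.card_eq_one_iff.2 ⟨⟨g, hg⟩, fun y => Subtype.ext (hu y.1 y.2)⟩
  · exact Fintype.card_eq_zero_iff.2 ⟨fun g => h (isNear_of_pentagon_coloring g.2)⟩

end Patterns

/-! ### Colourings of the pentagon and of the reduced pentagon -/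

section Pentagon

theorem boundaryCount_of_edgeEquiv {B E ι : Type*} {H : SimpleGraph B} (φ : E ≃ H.edgeSet)
    (w : ι → B) (c : ι → Fin 3) : boundaryCount H w c = Nat.card {g : E → Fin 3 //
      (∀ x i j, x ∈ (φ i).1 → x ∈ (φ j).1 → i ≠ j → g i ≠ g j) ∧
      (∀ k i, w k ∈ (φ i).1 → g i ≠ c k) ∧ ∀ k l, w k = w l → k ≠ l → c k ≠ c l} := by
  refine Nat.card_congr ((Equiv.arrowCongr φ.symm (Equiv.refl (Fin 3))).subtypeEquiv fun f => ?_)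
  constructor
  · exact fun h => ⟨fun x i j hi hj hij => h.edge hi hj (φ.injective.ne hij),
      fun k i hk => h.semiedge hk, fun k l => @h.terminal k l⟩
  · rintro ⟨h1, h2, h3⟩
    refine ⟨fun x e e' hx hx' hne => ?_, fun k e hk => ?_, fun k l => h3 k l⟩
    · obtain ⟨i, rfl⟩ := φ.surjective e
      obtain ⟨j, rfl⟩ := φ.surjective e'
      exact h1 x i j hx hx' fun h => hne (congrArg φ h)
    · obtain ⟨i, rfl⟩ := φ.surjective e
      exact h2 k i hk

/-- The pentagon with vertex set `ℤ/5ℤ`. -/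
def pentagonGraph : SimpleGraph (ZMod 5) where
  Adj x y := y = x + 1 ∨ x = y + 1
  symm := ⟨fun _ _ h => h.symm⟩
  loopless := ⟨by decide⟩

instance : DecidableRel pentagonGraph.Adj := fun x y =>
  inferInstanceAs (Decidable (y = x + 1 ∨ x = y + 1))

/-- The edges of the pentagon. -/
def pentagonEdge (k : ZMod 5) : pentagonGraph.edgeSet := ⟨s(k, k + 1), .inl rfl⟩

theorem pentagonEdge_bijective : Function.Bijective pentagonEdge := by
  constructor
  · intro k l h
    have h : s(k, k + 1) = s(l, l + 1) := congrArg Subtype.val h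
    revert k l
    decide
  · rintro ⟨e, he⟩
    induction e with
    | _ x y =>
      rcases he with h | h
      · obtain rfl : y = x + 1 := h
        exact ⟨x, rfl⟩
      · obtain rfl : x = y + 1 := h
        exact ⟨y, Subtype.ext Sym2.eq_swap⟩

theorem boundaryCount_pentagonGraph (c : ZMod 5 → Fin 3) :
    boundaryCount pentagonGraph id c = if IsNear c then 1 else 0 := by
  rw [← card_pentagon_colorings, ← Nat.card_eq_fintype_card,
    boundaryCount_of_edgeEquiv (Equiv.ofBijective _ pentagonEdge_bijective)]
  refine Nat.card_congr (Equiv.subtypeEquivRight fun g => ?_)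
  have hmem : ∀ x k : ZMod 5, x ∈ (pentagonEdge k).1 ↔ x = k ∨ x = k + 1 := fun x k =>
    Sym2.mem_iff
  simp only [Equiv.ofBijective_apply, hmem, id]
  constructor
  · rintro ⟨h1, h2, -⟩ k
    refine ⟨h1 (k + 1) k (k + 1) (.inr rfl) (.inl rfl) ?_, h2 k k (.inl rfl),
      h2 (k + 1) k (.inr rfl)⟩
    clear * -
    revert k
    decide
  · intro h
    refine ⟨?_, ?_, fun k l hkl hne => absurd hkl hne⟩
    · rintro x i j (rfl | rfl) (rfl | hj) hij
      · exact absurd rfl hij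
      · rw [hj]
        exact (h j).1.symm
      · exact (h i).1
      · exact absurd (add_right_cancel hj) hij
    · rintro k i (rfl | rfl)
      · exact (h k).2.1
      · exact (h i).2.2

/-- The two edges that remain when an edge of the pentagon is reduced. -/
def reducedPentagonEdge (k : ZMod 5) (i : Fin 2) :
    (reduction pentagonGraph s(k, k + 1)).edgeSet :=
  ⟨s(⟨k + 2 + (i.1 : ZMod 5), by revert k i; decide⟩,
      ⟨k + 3 + (i.1 : ZMod 5), by revert k i; decide⟩), by
    refine ⟨?_, .inl ?_⟩ <;> revert k i <;> decide⟩

theorem reducedPentagonEdge_bijective (k : ZMod 5) :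
    Function.Bijective (reducedPentagonEdge k) := by
  have hinj : ∀ k i j, (reducedPentagonEdge k i).1 = (reducedPentagonEdge k j).1 → i = j := by
    decide +kernel
  have hsurj : ∀ k, ∀ x y : {x : ZMod 5 // x ∉ s(k, k + 1)}, (x ≠ y ∧ (pentagonGraph.Adj x y ∨
      ∃ u ∈ s(k, k + 1), pentagonGraph.Adj u x ∧ pentagonGraph.Adj u y)) →
      ∃ i, (reducedPentagonEdge k i).1 = s(x, y) := by
    decide +kernel
  constructor
  · exact fun i j h => hinj k i j (congrArg Subtype.val h)
  · rintro ⟨e, he⟩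
    induction e with
    | _ x y => exact (hsurj k x y he).imp fun _ h => Subtype.ext h

/-- Where the semiedges of the pentagon end after the reduction of the edge at `k`. -/
def reducedPentagonEnd (k j : ZMod 5) : {x : ZMod 5 // x ∉ s(k, k + 1)} :=
  if h : j ∉ s(k, k + 1) then ⟨j, h⟩
  else if j = k then ⟨k + 4, by clear h; revert k; decide⟩
  else ⟨k + 2, by clear h; revert k; decide⟩

/-- What remains is the path `k + 2`, `k + 3`, `k + 4`; the semiedges of `k + 1` and `k` have moved
to its two ends, which now carry two semiedges each. -/
theorem boundaryCount_reducedPentagon (k : ZMod 5) (c : ZMod 5 → Fin 3) :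
    boundaryCount (reduction pentagonGraph s(k, k + 1)) (reducedPentagonEnd k) c =
      Fintype.card {g : Fin 2 → Fin 3 // g 0 ≠ g 1 ∧
        (g 0 ≠ c (k + 1) ∧ g 0 ≠ c (k + 2) ∧ g 0 ≠ c (k + 3)) ∧
        (g 1 ≠ c (k + 3) ∧ g 1 ≠ c (k + 4) ∧ g 1 ≠ c k) ∧
        c (k + 1) ≠ c (k + 2) ∧ c (k + 4) ≠ c k} := by
  rw [← Nat.card_eq_fintype_card,
    boundaryCount_of_edgeEquiv (Equiv.ofBijective _ (reducedPentagonEdge_bijective k))]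
  refine Nat.card_congr (Equiv.subtypeEquivRight fun g => ?_)
  have hmem0 : ∀ k j : ZMod 5, reducedPentagonEnd k j ∈ (reducedPentagonEdge k 0).1 ↔
      j = k + 1 ∨ j = k + 2 ∨ j = k + 3 := by decide +kernel
  have hmem1 : ∀ k j : ZMod 5, reducedPentagonEnd k j ∈ (reducedPentagonEdge k 1).1 ↔
      j = k + 3 ∨ j = k + 4 ∨ j = k := by decide +kernel
  have hend : ∀ k j l : ZMod 5, (reducedPentagonEnd k j = reducedPentagonEnd k l ∧ j ≠ l) ↔
      (j = k + 1 ∧ l = k + 2) ∨ (j = k + 2 ∧ l = k + 1) ∨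
      (j = k + 4 ∧ l = k) ∨ (j = k ∧ l = k + 4) := by decide +kernel
  simp only [Equiv.ofBijective_apply]
  refine and_congr ?_ ((and_congr ?_ ?_).trans and_assoc)
  · constructor
    · intro h
      exact h (reducedPentagonEnd k (k + 3)) 0 1 ((hmem0 _ _).2 (by simp))
        ((hmem1 _ _).2 (by simp)) (by decide)
    · intro h x i j _ _ hij
      fin_cases i <;> fin_cases j
      · exact absurd rfl hij
      · exact h
      · exact h.symm
      · exact absurd rfl hij
  · simp only [Fin.forall_fin_two, hmem0, hmem1, forall_and]
    simp [or_imp, forall_and]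
  · grind

/-- The two semiedges at each end of the path must differ, so one single colour sits at `k + 1` or
`k + 2` and the other at `k + 4` or `k`. Three of these four placements are far, each with 3! colour
assignments, and the colouring of the path is then unique: 18 = 3 · 6. -/
theorem sum_reducedPentagon (k : ZMod 5) (x : ℕ) :
    ∑ c, boundaryCount (reduction pentagonGraph s(k, k + 1)) (reducedPentagonEnd k) c *
      (if IsFar c then x else 0) = 18 * x := by
  have h : ∀ k : ZMod 5, ∑ c : ZMod 5 → Fin 3, (Fintype.card {g : Fin 2 → Fin 3 // g 0 ≠ g 1 ∧
        (g 0 ≠ c (k + 1) ∧ g 0 ≠ c (k + 2) ∧ g 0 ≠ c (k + 3)) ∧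
        (g 1 ≠ c (k + 3) ∧ g 1 ≠ c (k + 4) ∧ g 1 ≠ c k) ∧
        c (k + 1) ≠ c (k + 2) ∧ c (k + 4) ≠ c k}) * (if IsFar c then 1 else 0) = 18 := by
    decide +kernel
  rw [← h k, Finset.sum_mul]
  refine Finset.sum_congr rfl fun c _ => ?_
  rw [boundaryCount_reducedPentagon]
  split_ifs <;> simp

end Pentagon

/-! ### Short cycles excluded by the girth -/

section Girth

variable {V : Type*} {G : SimpleGraph V}

theorem not_triangle (hG : 5 ≤ G.egirth) {a b c : V} (hab : G.Adj a b) (hbc : G.Adj b c)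
    (hca : G.Adj c a) : False := by
  have h := le_egirth.1 hG a (.cons hab (.cons hbc (.cons hca .nil))) (by
    simp [Walk.isCycle_def, Walk.isTrail_def, hab.ne, hab.ne', hbc.ne, hca.ne, hca.ne'])
  exact absurd h (by simp; decide)

theorem not_square (hG : 5 ≤ G.egirth) {a b c d : V} (hab : G.Adj a b) (hbc : G.Adj b c)
    (hcd : G.Adj c d) (hda : G.Adj d a) (hac : a ≠ c) (hbd : b ≠ d) : False := by
  have h := le_egirth.1 hG a (.cons hab (.cons hbc (.cons hcd (.cons hda .nil)))) (by
    simp [Walk.isCycle_def, Walk.isTrail_def, hab.ne, hab.ne', hbc.ne, hcd.ne, hda.ne,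
      hda.ne', hac, hac.symm, hbd])
  exact absurd h (by simp; decide)

end Girth

/-- An isomorphism of graphs induces one of their reductions. -/
def reductionIso {V W : Type*} {K : SimpleGraph V} {M : SimpleGraph W} (φ : K ≃g M) (e : Sym2 V) :
    reduction K e ≃g reduction M (e.map φ) where
  toEquiv := φ.toEquiv.subtypeEquiv fun x => by
    rw [not_iff_not, Sym2.mem_map]
    constructor
    · exact fun h => ⟨x, h, rfl⟩
    · rintro ⟨y, hy, hxy⟩
      rwa [← φ.injective hxy]
  map_rel_iff' := by
    rintro ⟨x, hx⟩ ⟨y, hy⟩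
    simp [reduction, Sym2.mem_map, φ.map_adj_iff]

/-! ### A snark as a pentagon glued to its remainder -/

section Structure

variable {V : Type*} {G : SimpleGraph V} {u : ZMod 5 → V} {t : ZMod 5 → {x : V // x ∉ Set.range u}}

/-- Any two pentagon vertices are at distance at most 2 on the pentagon, so a common outer neighbour
would close a triangle or a 4-cycle. -/
theorem pentagonNeighbor_injective (hG : 5 ≤ G.egirth) (hu : IsPentagon G u)
    (ht : ∀ k, G.Adj (u k) (t k)) : Function.Injective t := by
  intro k l hkl
  by_contra hne
  have h1 := ht k
  have h2 := ht l
  rw [hkl] at h1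
  have hcases : ∀ k l : ZMod 5, k ≠ l → l = k + 1 ∨ k = l + 1 ∨ l = k + 1 + 1 ∨ k = l + 1 + 1 := by
    decide
  have hne2 : ∀ k : ZMod 5, k ≠ k + 1 + 1 := by decide
  have hmem : ∀ k, u k ≠ t l := fun k h => (t l).2 ⟨k, h⟩
  rcases hcases k l hne with h | h | h | h
  · exact not_triangle hG (h ▸ hu.2 k) h2 h1.symm
  · exact not_triangle hG (h ▸ hu.2 l) h1 h2.symm
  · exact not_square hG (hu.2 k) (h ▸ hu.2 (k + 1)) h2 h1.symm (hu.1.ne hne) (hmem _)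
  · exact not_square hG (hu.2 l) (h ▸ hu.2 (l + 1)) h1 h2.symm (hu.1.ne (Ne.symm hne)) (hmem _)

theorem pentagon_adj_iff (hcub : ∀ x, (G.neighborSet x).ncard = 3) (hu : IsPentagon G u)
    (ht : ∀ k, G.Adj (u k) (t k)) (k : ZMod 5) (x : V) :
    G.Adj (u k) x ↔ x = u (k + 1) ∨ x = u (k - 1) ∨ x = t k := by
  have hne : ∀ k : ZMod 5, k + 1 ≠ k - 1 := by decide
  have hmem : ∀ j, u j ≠ t k := fun j h => (t k).2 ⟨j, h⟩
  have hadj : G.Adj (u k) (u (k - 1)) := by simpa using (hu.2 (k - 1)).symm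
  have hsub : ({u (k + 1), u (k - 1), (t k : V)} : Set V) ⊆ G.neighborSet (u k) := by
    rintro _ (rfl | rfl | rfl)
    exacts [hu.2 k, hadj, ht k]
  have hcard : ({u (k + 1), u (k - 1), (t k : V)} : Set V).ncard = 3 :=
    Set.ncard_eq_three.2 ⟨_, _, _, hu.1.ne (hne k), hmem _, hmem _, rfl⟩
  have heq := Set.eq_of_subset_of_ncard_le hsub (by rw [hcub, hcard])
    (Set.finite_of_ncard_pos (by rw [hcub]; norm_num))
  rw [← mem_neighborSet, ← heq]
  rfl

theorem pentagon_adj_coe_iff (hcub : ∀ x, (G.neighborSet x).ncard = 3) (hu : IsPentagon G u)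
    (ht : ∀ k, G.Adj (u k) (t k)) (k : ZMod 5) (x : {x : V // x ∉ Set.range u}) :
    G.Adj (u k) x ↔ t k = x := by
  rw [pentagon_adj_iff hcub hu ht]
  constructor
  · rintro (h | h | h)
    · exact absurd ⟨_, h.symm⟩ x.2
    · exact absurd ⟨_, h.symm⟩ x.2
    · exact Subtype.ext h.symm
  · rintro rfl
    exact .inr (.inr rfl)

/-- A cubic graph is recovered by gluing the pentagon to what remains after deleting it. -/
noncomputable def pentagonGlueIso (hcub : ∀ x, (G.neighborSet x).ncard = 3) (hu : IsPentagon G u)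
    (ht : ∀ k, G.Adj (u k) (t k)) : glue pentagonGraph (deletePentagon G u) id t ≃g G where
  toEquiv := Equiv.ofBijective (Sum.elim u Subtype.val) (by
    constructor
    · rintro (k | x) (l | y) h
      · exact congrArg _ (hu.1 h)
      · exact absurd ⟨k, h⟩ y.2
      · exact absurd ⟨l, h.symm⟩ x.2
      · exact congrArg _ (Subtype.ext h)
    · intro x
      by_cases hx : x ∈ Set.range u
      · obtain ⟨k, rfl⟩ := hx
        exact ⟨.inl k, rfl⟩
      · exact ⟨.inr ⟨x, hx⟩, rfl⟩)
  map_rel_iff' := by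
    have hx : ∀ k (x : {x : V // x ∉ Set.range u}), G.Adj (u k) x ↔ ∃ l, l = k ∧ t l = x :=
      fun k x => by simp [pentagon_adj_coe_iff hcub hu ht]
    rintro (k | x) (l | y)
    · change G.Adj (u k) (u l) ↔ _
      rw [glue_adj_inl_inl, pentagon_adj_iff hcub hu ht]
      have h1 : u l ≠ t k := fun h => (t k).2 ⟨l, h⟩
      simp only [h1, or_false, hu.1.eq_iff]
      change _ ↔ l = k + 1 ∨ k = l + 1
      rw [eq_sub_iff_add_eq, eq_comm (a := l + 1)]
    · exact (hx k y).trans glue_adj_inl_inr.symm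
    · change G.Adj x (u l) ↔ _
      rw [adj_comm, hx]
      simp
    · exact (glue_adj_inr_inr (L := pentagonGraph) (H := deletePentagon G u) (b := x)).symm

theorem isCubicAt_deletePentagon (hcub : ∀ x, (G.neighborSet x).ncard = 3) (hu : IsPentagon G u)
    (ht : ∀ k, G.Adj (u k) (t k)) : IsCubicAt (deletePentagon G u) t := by
  intro x
  rw [← hcub x, ← Nat.card_coe_set_eq]
  have hx : ∀ k, G.Adj x (u k) ↔ t k = x := fun k => by
    rw [adj_comm, pentagon_adj_coe_iff hcub hu ht]
  refine Nat.card_congr (Equiv.ofBijective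
    (Sum.elim (fun y => ⟨y.1.1, y.2⟩) fun k => ⟨u k.1, (hx k.1).2 k.2⟩) ?_)
  constructor
  · rintro (⟨y, hy⟩ | ⟨k, hk⟩) (⟨z, hz⟩ | ⟨l, hl⟩) h <;> have h := congrArg Subtype.val h
    · have : y = z := Subtype.ext h
      subst this
      rfl
    · exact absurd ⟨l, h.symm⟩ y.2
    · exact absurd ⟨k, h⟩ z.2
    · have : k = l := hu.1 h
      subst this
      rfl
  · rintro ⟨y, hy⟩
    by_cases hyu : y ∈ Set.range u
    · obtain ⟨k, rfl⟩ := hyu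
      exact ⟨.inr ⟨k, (hx k).1 hy⟩, rfl⟩
    · exact ⟨.inl ⟨⟨y, hyu⟩, hy⟩, rfl⟩

/-- The vertex `t (σ 0)` loses only one neighbour with the pentagon, because `t` is injective, and
gains one across the gluing. -/
theorem hasClaw_glue_deletePentagon {B : Type*} {R : SimpleGraph B} {s : ZMod 5 → B}
    (hcub : ∀ x, (G.neighborSet x).ncard = 3) (hu : IsPentagon G u)
    (hinj : Function.Injective t) (ht : ∀ k, G.Adj (u k) (t k)) (σ : ZMod 5 → ZMod 5) :
    HasClaw (glue (deletePentagon G u) R (fun k => t (σ k)) s) := by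
  obtain ⟨a, b, c, hab, hac, hbc, hN⟩ := Set.ncard_eq_three.1 (hcub (t (σ 0)))
  have hmem : ∀ y, G.Adj (t (σ 0)) y ↔ y = a ∨ y = b ∨ y = c := fun y => by
    rw [← mem_neighborSet, hN]
    rfl
  have huniq : ∀ k, G.Adj (t (σ 0)) (u k) → k = σ 0 := fun k h =>
    hinj ((pentagon_adj_coe_iff hcub hu ht k _).1 h.symm)
  have claw : ∀ y z, y ≠ z → G.Adj (t (σ 0)) y → G.Adj (t (σ 0)) z → y ≠ u (σ 0) → z ≠ u (σ 0) →
      HasClaw (glue (deletePentagon G u) R (fun k => t (σ k)) s) := by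
    intro y z hyz hy hz hyu hzu
    have hyr : y ∉ Set.range u := by
      rintro ⟨k, rfl⟩
      exact hyu (congrArg u (huniq k hy))
    have hzr : z ∉ Set.range u := by
      rintro ⟨k, rfl⟩
      exact hzu (congrArg u (huniq k hz))
    refine ⟨.inl (t (σ 0)), .inl ⟨y, hyr⟩, .inl ⟨z, hzr⟩, .inr (s 0), ?_, ?_, ?_, ?_, ?_, ?_⟩
    · exact glue_adj_inl_inl.2 hy
    · exact glue_adj_inl_inl.2 hz
    · exact glue_adj_inl_inr.2 ⟨0, rfl, rfl⟩
    · simpa using hyz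
    · simp
    · simp
  rcases (hmem (u (σ 0))).1 (ht _).symm with h | h | h
  · exact claw b c hbc ((hmem b).2 (by simp)) ((hmem c).2 (by simp)) (h ▸ hab.symm) (h ▸ hac.symm)
  · exact claw a c hac ((hmem a).2 (by simp)) ((hmem c).2 (by simp)) (h ▸ hab) (h ▸ hbc.symm)
  · exact claw a b hab ((hmem a).2 (by simp)) ((hmem b).2 (by simp)) (h ▸ hac) (h ▸ hbc)

/-- A colouring of the remainder with near boundary would extend over the pentagon to a
3-edge-colouring of the snark. -/
theorem boundaryCount_eq_zero_of_isNear [Finite V] (hG : IsSnark G) (hu : IsPentagon G u)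
    (ht : ∀ k, G.Adj (u k) (t k)) (c : ZMod 5 → Fin 3) (hc : IsNear c) :
    boundaryCount (deletePentagon G u) t c = 0 := by
  have h0 : colorCount G = 0 := by
    rw [colorCount, Nat.card_eq_zero]
    exact .inl (not_nonempty_iff.1 hG.not_colorable)
  rw [← colorCount_congr (pentagonGlueIso hG.cubic hu ht),
    colorCount_glue (t := id) (fun k l h => (Prod.ext_iff.1 h).1), Finset.sum_eq_zero_iff] at h0
  have h := h0 c (Finset.mem_univ c)
  rwa [boundaryCount_pentagonGraph, if_pos hc, one_mul] at h

theorem psi_pentagon [Finite V] (hG : IsSnark G) (hu : IsPentagon G u)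
    (ht : ∀ k, G.Adj (u k) (t k)) {x : ℕ}
    (hx : ∀ c, boundaryCount (deletePentagon G u) t c = if IsFar c then x else 0) (k : ZMod 5) :
    psi G s(u k, u (k + 1)) = x := by
  let φ := (pentagonGlueIso hG.cubic hu ht).symm.trans
    (glueComm pentagonGraph (deletePentagon G u) id t)
  have hφ : ∀ k, φ (u k) = .inr k := by
    intro k
    have : (pentagonGlueIso hG.cubic hu ht).symm (u k) = .inl k := by
      rw [RelIso.symm_apply_eq]
      rfl
    change Sum.swap ((pentagonGlueIso hG.cubic hu ht).symm (u k)) = _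
    rw [this]
    rfl
  have he : s(u k, u (k + 1)).map φ = s(k, k + 1).map Sum.inr := by
    simp [hφ]
  have ψ := reductionGlueIso (deletePentagon G u) pentagonGraph t id Function.injective_id
    s(k, k + 1) (reducedPentagonEnd k) (by
      clear * -
      revert k
      decide +kernel) (by
      clear * -
      revert k
      decide +kernel)
  rw [← he] at ψ
  have hclaw : HasClaw (glue (deletePentagon G u) (reduction pentagonGraph s(k, k + 1)) t
      (reducedPentagonEnd k)) := by
    -- The vertex `k + 3`, opposite the reduced edge, keeps both its pentagon neighbours and its
    -- semiedge.
    refine ⟨.inr (reducedPentagonEnd k (k + 3)), .inr (reducedPentagonEnd k (k + 2)),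
      .inr (reducedPentagonEnd k (k + 4)), .inl (t (k + 3)), ?_, ?_, ?_, ?_, by simp, by simp⟩
    · rw [glue_adj_inr_inr, reduction]
      clear * -
      revert k
      decide +kernel
    · rw [glue_adj_inr_inr, reduction]
      clear * -
      revert k
      decide +kernel
    · exact glue_adj_inr_inl.2 ⟨_, rfl, rfl⟩
    · rw [Sum.inr_injective.ne_iff]
      clear * -
      revert k
      decide +kernel
  rw [psi_eq_colorCount ((reductionIso φ _).trans ψ) hclaw, colorCount_glue (fun k l h =>
    pentagonNeighbor_injective hG.five_le_girth hu ht (Prod.ext_iff.1 h).1)]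
  have hsum := sum_reducedPentagon k x
  simp only [← hx, mul_comm (boundaryCount (reduction _ _) _ _)] at hsum
  rw [hsum]
  push_cast
  ring

/-- The boundary colourings of a snark with a pentagon deleted. -/
theorem exists_boundaryCount [Finite V] (hG : IsSnark G) (hu : IsPentagon G u)
    (ht : ∀ k, G.Adj (u k) (t k)) : ∃ x : ℕ,
    (∀ c, boundaryCount (deletePentagon G u) t c = if IsFar c then x else 0) ∧
    ∀ k, psi G s(u k, u (k + 1)) = x :=
  have h := boundaryCount_eq_ite (isCubicAt_deletePentagon hG.cubic hu ht)
    (boundaryCount_eq_zero_of_isNear hG hu ht)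
  ⟨_, h, psi_pentagon hG hu ht h⟩

end Structure

/-! ### The product formula for the glued graph -/

section Product

variable {V : Type*} {G : SimpleGraph V} {u : ZMod 5 → V} {t : ZMod 5 → {x : V // x ∉ Set.range u}}

/-- After the reduction of an edge that misses the pentagon, the semiedges can be attached to
vertices that survive. -/
theorem exists_reduced_ends (hG : IsSnark G) (hu : IsPentagon G u)
    (ht : ∀ k, G.Adj (u k) (t k)) {e : Sym2 {x : V // x ∉ Set.range u}}
    (he : e ∈ (deletePentagon G u).edgeSet) : ∃ t' : ZMod 5 → {x // x ∉ e},
    (∀ k, t k ∉ e → (t' k : {x : V // x ∉ Set.range u}) = t k) ∧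
    ∀ k, t k ∈ e → ∀ z, z ∉ e → ((deletePentagon G u).Adj (t k) z ↔ z = t' k) := by
  have h : ∀ k, ∃ b : {x // x ∉ e}, (t k ∉ e → b.1 = t k) ∧
      (t k ∈ e → ∀ z, z ∉ e → ((deletePentagon G u).Adj (t k) z ↔ z = b)) := by
    intro k
    by_cases hk : t k ∈ e
    · obtain ⟨y, rfl⟩ := Sym2.mem_iff_exists.1 hk
      have hy : G.Adj (t k) y := he
      obtain ⟨b, hb, hN⟩ : ∃ b, (b ≠ u k ∧ b ≠ y) ∧
          ∀ z, G.Adj (t k) z ↔ z = u k ∨ z = y ∨ z = b := by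
        have hne : u k ≠ y := fun h => y.2 ⟨k, h⟩
        have hsub : ({u k, (y : V)} : Set V) ⊆ G.neighborSet (t k) := by
          rintro _ (rfl | rfl)
          exacts [(ht k).symm, hy]
        have hfin : (G.neighborSet (t k)).Finite :=
          Set.finite_of_ncard_pos (by rw [hG.cubic]; norm_num)
        obtain ⟨b, hb, hb'⟩ := Set.exists_mem_notMem_of_ncard_lt_ncard
          (s := {u k, (y : V)}) (t := G.neighborSet (t k))
          (by rw [Set.ncard_pair hne, hG.cubic]; norm_num)
        simp only [Set.mem_insert_iff, Set.mem_singleton_iff, not_or] at hb'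
        refine ⟨b, hb', fun z => ?_⟩
        have heq := Set.eq_of_subset_of_ncard_le (s := {u k, (y : V), b})
          (t := G.neighborSet (t k)) (by
            rintro _ (rfl | rfl | rfl)
            exacts [(ht k).symm, hy, hb])
          (by rw [hG.cubic, Set.ncard_eq_three.2 ⟨_, _, _, hne, Ne.symm hb'.1, Ne.symm hb'.2, rfl⟩]) hfin
        rw [← mem_neighborSet, ← heq]
        rfl
      have hbt : G.Adj (t k) b := (hN b).2 (by simp)
      have hbu : b ∉ Set.range u := by
        rintro ⟨j, rfl⟩
        have := pentagonNeighbor_injective hG.five_le_girth hu ht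
          ((pentagon_adj_coe_iff hG.cubic hu ht j (t k)).1 hbt.symm)
        exact hb.1 (congrArg u this)
      refine ⟨⟨⟨b, hbu⟩, ?_⟩, fun h => absurd hk h, fun _ z hz => ?_⟩
      · rw [Sym2.mem_iff, not_or]
        exact ⟨fun h => hbt.ne (congrArg Subtype.val h).symm,
          fun h => hb.2 (congrArg Subtype.val h)⟩
      · rw [Sym2.mem_iff, not_or] at hz
        change G.Adj (t k) z ↔ _
        rw [hN]
        constructor
        · rintro (h | h | h)
          · exact absurd ⟨k, h.symm⟩ z.2
          · exact absurd (Subtype.ext h) hz.2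
          · exact Subtype.ext h
        · rintro rfl
          exact .inr (.inr rfl)
    · exact ⟨⟨t k, hk⟩, fun _ => rfl, fun h => absurd h hk⟩
  choose t' ht' using h
  exact ⟨t', fun k => (ht' k).1, fun k => (ht' k).2⟩

/-- The Kászonyi number of an edge that misses a pentagon. -/
theorem psi_map_val [Finite V] (hG : IsSnark G) (hu : IsPentagon G u)
    (ht : ∀ k, G.Adj (u k) (t k)) {e : Sym2 {x : V // x ∉ Set.range u}}
    {t' : ZMod 5 → {x // x ∉ e}}
    (ht1 : ∀ k, t k ∉ e → (t' k : {x : V // x ∉ Set.range u}) = t k)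
    (ht2 : ∀ k, t k ∈ e → ∀ z, z ∉ e → ((deletePentagon G u).Adj (t k) z ↔ z = t' k)) :
    psi G (e.map Subtype.val) = (∑ c, if IsNear c then
      boundaryCount (reduction (deletePentagon G u) e) t' c else 0 : ℕ) / 18 := by
  let φ := pentagonGlueIso hG.cubic hu ht
  have he : (e.map Sum.inr).map φ = e.map Subtype.val := by
    rw [Sym2.map_map]
    rfl
  have ψ := reductionIso φ (e.map Sum.inr)
  rw [he] at ψ
  have hclaw : HasClaw (glue pentagonGraph (reduction (deletePentagon G u) e) id t') := by
    refine ⟨.inl 0, .inl 1, .inl 4, .inr (t' 0), glue_adj_inl_inl.2 (.inl (by decide)),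
      glue_adj_inl_inl.2 (.inr (by decide)), glue_adj_inl_inr.2 ⟨0, rfl, rfl⟩, ?_, by simp,
      by simp⟩
    rw [Sum.inl_injective.ne_iff]
    decide
  rw [psi_eq_colorCount (ψ.symm.trans (reductionGlueIso _ _ id t
    (pentagonNeighbor_injective hG.five_le_girth hu ht) e t' ht1 ht2)) hclaw,
    colorCount_glue (t := id) (fun k l h => (Prod.ext_iff.1 h).1)]
  simp only [boundaryCount_pentagonGraph, ite_mul, one_mul, zero_mul]

/-- Multiplication by `2` on `ℤ/5ℤ`. -/
def mulTwo : ZMod 5 ≃ ZMod 5 where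
  toFun k := 2 * k
  invFun k := 3 * k
  left_inv := by decide
  right_inv := by decide

theorem sum_comp_two {M : Type*} [AddCommMonoid M] (F : (ZMod 5 → Fin 3) → M) :
    ∑ c, F c = ∑ c : ZMod 5 → Fin 3, F fun k => c (2 * k) :=
  (Equiv.sum_comp (Equiv.arrowCongr mulTwo.symm (Equiv.refl (Fin 3))) F).symm

theorem pentagonGluing_eq_glue {A B : Type*} (L : SimpleGraph A) (R : SimpleGraph B)
    (t : ZMod 5 → A) (w : ZMod 5 → B) : pentagonGluing L R t w = glue L R t (w ∘ mulTwo) :=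
  rfl

variable {W : Type*} {H : SimpleGraph W} {v : ZMod 5 → W} {w : ZMod 5 → {x : W // x ∉ Set.range v}}

theorem psi_pentagonGluing_inr [Finite V] [Finite W] (hG : IsSnark G) (hH : IsSnark H)
    (hu : IsPentagon G u) (hv : IsPentagon H v) (ht : ∀ k, G.Adj (u k) (t k))
    (hw : ∀ k, H.Adj (v k) (w k)) {e : Sym2 {x : W // x ∉ Set.range v}}
    (he : e ∈ (deletePentagon H v).edgeSet) (k : ZMod 5) :
    psi (pentagonGluing (deletePentagon G u) (deletePentagon H v) t w) (e.map Sum.inr) =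
      psi H (e.map Subtype.val) * psi G s(u k, u (k + 1)) := by
  obtain ⟨x, hx, hpsi⟩ := exists_boundaryCount hG hu ht
  obtain ⟨w', hw1, hw2⟩ := exists_reduced_ends hH hv hw he
  have hwinj := pentagonNeighbor_injective hH.five_le_girth hv hw
  have htinj := pentagonNeighbor_injective hG.five_le_girth hu ht
  have φ := reductionGlueIso (deletePentagon G u) (deletePentagon H v) t (w ∘ mulTwo)
    (hwinj.comp mulTwo.injective) e (w' ∘ mulTwo) (fun k => hw1 _) (fun k => hw2 _)
  rw [pentagonGluing_eq_glue, psi_map_val hH hv hw hw1 hw2, hpsi, psi_eq_colorCount φ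
    (hasClaw_glue_deletePentagon hG.cubic hu htinj ht id),
    colorCount_glue (fun k l h => htinj (Prod.ext_iff.1 h).1), sum_comp_two]
  -- After the substitution by `sum_comp_two`, `c` is indexed as in `H`, and the far patterns on the
  -- `G` side become the near patterns of `c`.
  have hsum : ∀ c : ZMod 5 → Fin 3, boundaryCount (deletePentagon G u) t (fun k => c (2 * k)) *
      boundaryCount (reduction (deletePentagon H v) e) (w' ∘ mulTwo) (fun k => c (2 * k)) =
      (if IsNear c then boundaryCount (reduction (deletePentagon H v) e) w' c else 0) * x := by
    intro c
    rw [hx, show boundaryCount (reduction (deletePentagon H v) e) (w' ∘ mulTwo)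
      (fun k => c (2 * k)) = _ from boundaryCount_reindex mulTwo c]
    simp only [isFar_comp_two]
    split_ifs <;> ring
  rw [Finset.sum_congr rfl fun c _ => hsum c, ← Finset.sum_mul]
  push_cast
  ring

theorem psi_pentagonGluing_inl [Finite V] [Finite W] (hG : IsSnark G) (hH : IsSnark H)
    (hu : IsPentagon G u) (hv : IsPentagon H v) (ht : ∀ k, G.Adj (u k) (t k))
    (hw : ∀ k, H.Adj (v k) (w k)) {e : Sym2 {x : V // x ∉ Set.range u}}
    (he : e ∈ (deletePentagon G u).edgeSet) (k : ZMod 5) :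
    psi (pentagonGluing (deletePentagon G u) (deletePentagon H v) t w) (e.map Sum.inl) =
      psi G (e.map Subtype.val) * psi H s(v k, v (k + 1)) := by
  obtain ⟨x, hx, hpsi⟩ := exists_boundaryCount hH hv hw
  obtain ⟨t', ht1, ht2⟩ := exists_reduced_ends hG hu ht he
  have hwinj := pentagonNeighbor_injective hH.five_le_girth hv hw
  have htinj := pentagonNeighbor_injective hG.five_le_girth hu ht
  let φ := glueComm (deletePentagon G u) (deletePentagon H v) t (w ∘ mulTwo)
  have ψ := reductionIso φ (e.map Sum.inl)
  have hmap : (e.map Sum.inl).map φ = e.map Sum.inr := by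
    rw [Sym2.map_map]
    rfl
  rw [hmap] at ψ
  have χ := ψ.trans (reductionGlueIso (deletePentagon H v) (deletePentagon G u) (w ∘ mulTwo) t
    htinj e t' ht1 ht2)
  rw [pentagonGluing_eq_glue, psi_map_val hG hu ht ht1 ht2, hpsi, psi_eq_colorCount χ
    (hasClaw_glue_deletePentagon hH.cubic hv hwinj hw mulTwo),
    colorCount_glue (t := w ∘ mulTwo) (fun k l h => mulTwo.injective (hwinj (Prod.ext_iff.1 h).1))]
  have hsum : ∀ c : ZMod 5 → Fin 3, boundaryCount (deletePentagon H v) (w ∘ mulTwo) c *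
      boundaryCount (reduction (deletePentagon G u) e) t' c =
      (if IsNear c then boundaryCount (reduction (deletePentagon G u) e) t' c else 0) * x := by
    intro c
    -- Here `c` is already indexed as in `G`; since 3 inverts 2 modulo 5, the other side sees it as
    -- `c (3 * k)`.
    have hc : c = (fun k => c (3 * k)) ∘ mulTwo :=
      funext fun k => (congrArg c (mulTwo.symm_apply_apply k)).symm
    rw [show boundaryCount (deletePentagon H v) (w ∘ mulTwo) c =
      boundaryCount (deletePentagon H v) w (fun k => c (3 * k)) by
        conv_lhs => rw [hc, boundaryCount_reindex], hx]
    simp only [isFar_comp_three]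
    split_ifs <;> ring
  rw [Finset.sum_congr rfl fun c _ => hsum c, ← Finset.sum_mul]
  push_cast
  ring

end Product

end Snark

theorem theorem4p8 {V W : Type*} [Finite V] [Finite W]
    (G' : SimpleGraph V) (Gs : SimpleGraph W)
    (hG' : Snark.IsSnark G') (hGs : Snark.IsSnark Gs)
    (u : ZMod 5 → V) (hu : Snark.IsPentagon G' u)
    (v : ZMod 5 → W) (hv : Snark.IsPentagon Gs v)
    (t : ZMod 5 → {x : V // x ∉ Set.range u}) (ht : ∀ k, G'.Adj (t k) (u k))
    (w : ZMod 5 → {x : W // x ∉ Set.range v}) (hw : ∀ k, Gs.Adj (v k) (w k))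
    (G : SimpleGraph ({x : V // x ∉ Set.range u} ⊕ {x : W // x ∉ Set.range v}))
    (hG : G = Snark.pentagonGluing
      (Snark.deletePentagon G' u) (Snark.deletePentagon Gs v) t w) :
    (∀ e ∈ (Snark.deletePentagon Gs v).edgeSet,
      e.map Sum.inr ∈ G.edgeSet ∧
      ∀ k, Snark.psi G (e.map Sum.inr) =
        Snark.psi Gs (e.map Subtype.val) * Snark.psi G' s(u k, u (k + 1))) ∧
    (∀ e ∈ (Snark.deletePentagon G' u).edgeSet,
      e.map Sum.inl ∈ G.edgeSet ∧
      ∀ k, Snark.psi G (e.map Sum.inl) =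
        Snark.psi G' (e.map Subtype.val) * Snark.psi Gs s(v k, v (k + 1))) := by
  subst hG
  refine ⟨fun e he => ⟨?_, Snark.psi_pentagonGluing_inr hG' hGs hu hv (fun k => (ht k).symm) hw he⟩,
    fun e he => ⟨?_, Snark.psi_pentagonGluing_inl hG' hGs hu hv (fun k => (ht k).symm) hw he⟩⟩
  · induction e with
    | _ x y => exact Snark.glue_adj_inr_inr.2 he
  · induction e with
    | _ x y => exact Snark.glue_adj_inl_inl.2 he
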